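/- A \emph{precontraction group} is a totally ordered abelian group $\Gamma$ with a map $\chi:\Gamma\to\Gamma$ such that for all $a,b\in\Gamma$: $\chi(a)=0\iff a=0$; $a\le b\Rightarrow\chi(a)\le\chi(b)$; $\chi(-a)=-\chi(a)$; and $\chi(a)=\chi(b)$ whenever $a,b$ are archimedean equivalent and have the same sign. It is \emph{centripetal} if $|\chi(a)|<|a|$ for all $a\neq 0$. Let $T_{pdg}$ be the theory, in the language $L_{pdg}=\{+,-,0,<,\chi,c\}$, whose models are the nontrivial divisible centripetal precontraction groups $(\Gamma,\chi)$ with a constant $c$ such that: $c$ is the least element of $\chi(\Gamma^{<0})$; $\chi$ restricts to a bijection $\chi(\Gamma^{<0})\to\chi(\Gamma^{<0})^{>c}$; and for all $a<b$ in $\chi(\Gamma^{<0})$ one has $a<\chi(a)\le b$. Let $L_{pdg*}=L_{pdg}\cup\{\infty,\chi^{-1},\delta_1,\delta_2,\dots\}$, with $\infty$ a constant symbol and $\chi^{-1},\delta_n$ ($n\ge 1$) unary function symbols. Each model $(\Gamma,\chi)$ of $T_{pdg}$ expands to an $L_{pdg*}$-structure on $\Gamma_\infty=\Gamma\cup\{\infty\}$,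 $\infty\notin\Gamma$, as follows: $a<\infty$ and $a+\infty=\infty+a=\infty$ for $a\in\Gamma$; $\infty+\infty=-\infty=\chi(\infty)=\infty$; $\delta_n$ is division by $n$ on $\Gamma$, and $\delta_n(\infty)=\infty$; $\chi^{-1}$ is on $\chi(\Gamma^{<0})^{>c}$ the inverse of the bijection $\chi:\chi(\Gamma^{<0})\to\chi(\Gamma^{<0})^{>c}$, $\chi^{-1}(0)=0$, $\chi^{-1}(c)=\infty$, and $\chi^{-1}(a)=\infty$ for all $a\in\Gamma_\infty\setminus\{0\}$ with $a\notin\chi(\Gamma)$. On $\chi(\Gamma^{>0})$ fix one of the two conventions: (i) $\chi^{-1}(a)=\infty$ for all $a\in\chi(\Gamma^{>0})$; or (ii) $\chi^{-1}(a)=-\chi^{-1}(-a)$ for all $a\in\chi(\Gamma^{>0})$. Let $T_{pdg*}$ be the $L_{pdg*}$-theory whose models are (up to isomorphism) exactly these expansions of models of $T_{pdg}$. Then, under either convention, $T_{pdg*}$ has quantifier elimination: for every $n\ge 0$ and every $L_{pdg*}$-formula $\varphi(x_1,\dots,x_n)$ there is a quantifier-free $L_{pdg*}$-formula $\psi(x_1,\dots,x_n)$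 such that $T_{pdg*}\models\forall x_1\cdots\forall x_n\,(\varphi\leftrightarrow\psi)$. -/

import Mathlib

universe u

namespace Pdg

/-! ### Precontraction groups and the models of `T_pdg` -/

section Groups

variable {Γ : Type u} [AddCommGroup Γ] [LinearOrder Γ] [IsOrderedAddMonoid Γ]

/-- `χ` is a precontraction map on the ordered abelian group `Γ`. -/
structure IsPrecontraction (χ : Γ → Γ) : Prop where
  eq_zero_iff : ∀ a, χ a = 0 ↔ a = 0
  mono : ∀ a b, a ≤ b → χ a ≤ χ b
  map_neg : ∀ a, χ (-a) = -χ a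
  arch : ∀ a b, ArchimedeanClass.mk a = ArchimedeanClass.mk b →
    SignType.sign a = SignType.sign b → χ a = χ b

/-- The precontraction group `(Γ, χ)` is centripetal. -/
structure IsCentripetal (χ : Γ → Γ) : Prop extends IsPrecontraction χ where
  centripetal : ∀ a, a ≠ 0 → |χ a| < |a|

/-- The set `χ(Γ^{<0})`. -/
def negImage (χ : Γ → Γ) : Set Γ := χ '' Set.Iio 0

/-- `(Γ, χ, c)` is a model of `T_pdg`: a nontrivial divisible centripetal precontraction group
such that `χ(Γ^{<0})` has least element `c`, the map `χ` is a bijection from `χ(Γ^{<0})` onto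
`χ(Γ^{<0})^{>c}`, and `χ a` is the immediate successor of `a` in `χ(Γ^{<0})`. -/
structure IsModel (χ : Γ → Γ) (c : Γ) : Prop extends IsCentripetal χ where
  nontrivial : Nontrivial Γ
  isLeast : IsLeast (negImage χ) c
  bijOn : Set.BijOn χ (negImage χ) (negImage χ ∩ Set.Ioi c)
  succ : ∀ a ∈ negImage χ, ∀ b ∈ negImage χ, a < b → a < χ a ∧ χ a ≤ b
  divisible : ∀ n : ℕ, 0 < n → ∀ a : Γ, ∃ b : Γ, n • b = a

end Groups

/-! ### The language `L_pdg*` and the expansions of the models of `T_pdg` -/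

/-- The function symbols of `L_pdg*`: the constants `0`, `c`, `∞`, the unary symbols `-`, `χ`,
`χ⁻¹` and `δ_n` for `n > 0`, and the binary symbol `+`. -/
inductive Func : ℕ → Type
  | zero : Func 0
  | c : Func 0
  | infty : Func 0
  | neg : Func 1
  | chi : Func 1
  | chiInv : Func 1
  | delta (n : ℕ+) : Func 1
  | add : Func 2

/-- The only relation symbol of `L_pdg*`: the strict order. -/
inductive Rel : ℕ → Type
  | lt : Rel 2

/-- The language `L_pdg*`. -/
def Lang : FirstOrder.Language.{0, 0} := ⟨Func, Rel⟩

/-- The value of `χ⁻¹` at the elements of `χ(Γ^{>0})`: either always `∞` (so that `χ⁻¹` inverts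
`χ` on `χ(Γ^{<0})` only), or given by `χ⁻¹(-x) = -χ⁻¹(x)`. -/
inductive Convention : Type
  | infty
  | odd

section Expansion

variable {Γ : Type u} [AddCommGroup Γ] [LinearOrder Γ] [IsOrderedAddMonoid Γ]

open Classical in
/-- The function `χ⁻¹ : Γ ∪ {∞} → Γ ∪ {∞}`: it is the inverse of the bijection
`χ : χ(Γ^{<0}) → χ(Γ^{<0})^{>c}` on the image of the latter, `0` at `0`, governed by the convention
on `χ(Γ^{>0})`, and `∞` everywhere else, in particular at `c` and at `∞`. -/
noncomputable def chiInv (conv : Convention) (χ : Γ → Γ) : WithTop Γ → WithTop Γ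
  | ⊤ => ⊤
  | (a : Γ) =>
    if a ∈ χ '' negImage χ then ((Function.invFunOn χ (negImage χ) a : Γ) : WithTop Γ)
    else if a = 0 then 0
    else match conv with
      | .infty => ⊤
      | .odd =>
        if -a ∈ χ '' negImage χ then ((-Function.invFunOn χ (negImage χ) (-a) : Γ) : WithTop Γ)
        else ⊤

/-- Division by `n` on `Γ ∪ {∞}`, with `∞ / n = ∞`. -/
noncomputable def divBy (n : ℕ+) : WithTop Γ → WithTop Γ :=
  WithTop.map (Function.invFun fun b : Γ => (n : ℕ) • b)

/-- The `L_pdg*`-structure on `Γ ∪ {∞}` that expands `(Γ, χ, c)`. Here `x + ∞ = ∞ + x = ∞` and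
`x < ∞` for all `x ∈ Γ`, and `-∞ = χ(∞) = ∞`. -/
@[reducible] noncomputable def expansion (conv : Convention) (χ : Γ → Γ) (c : Γ) :
    Lang.Structure (WithTop Γ) where
  funMap {n} (f : Func n) := match n, f with
    | _, .zero => fun _ => 0
    | _, .c => fun _ => (c : WithTop Γ)
    | _, .infty => fun _ => ⊤
    | _, .neg => fun v => WithTop.map (fun a : Γ => -a) (v 0)
    | _, .chi => fun v => WithTop.map χ (v 0)
    | _, .chiInv => fun v => chiInv conv χ (v 0)
    | _, .delta n => fun v => divBy n (v 0)
    | _, .add => fun v => v 0 + v 1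
  RelMap {n} (r : Rel n) := match n, r with
    | _, .lt => fun v => v 0 < v 1

end Expansion

/-- The `L_pdg*`-structure `M` is (isomorphic to) the expansion of a model of `T_pdg`. -/
def IsExpansion (conv : Convention) (M : Type u) [S : Lang.Structure M] : Prop :=
  ∃ (Γ : Type u) (_ : AddCommGroup Γ) (_ : LinearOrder Γ) (_ : IsOrderedAddMonoid Γ)
    (χ : Γ → Γ) (c : Γ), IsModel χ c ∧
      Nonempty (@FirstOrder.Language.Equiv Lang M (WithTop Γ) S (expansion conv χ c))

/-! ### An axiomatization of `T_pdg*` -/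

section Axioms

open FirstOrder FirstOrder.Language

variable {n : ℕ}

/-- Terms in the bound variables `&0, …, &(n - 1)`. -/
abbrev Tm (n : ℕ) := Lang.Term (Empty ⊕ Fin n)

/-- The term `0`. -/
def tZero : Tm n := Term.func (L := Lang) Func.zero ![]
/-- The term `c`. -/
def tC : Tm n := Term.func (L := Lang) Func.c ![]
/-- The term `∞`. -/
def tInf : Tm n := Term.func (L := Lang) Func.infty ![]
/-- The term `-s`. -/
def tNeg (s : Tm n) : Tm n := Functions.apply₁ (L := Lang) Func.neg s
/-- The term `χ(s)`. -/
def tChi (s : Tm n) : Tm n := Functions.apply₁ (L := Lang) Func.chi s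
/-- The term `χ⁻¹(s)`. -/
def tInv (s : Tm n) : Tm n := Functions.apply₁ (L := Lang) Func.chiInv s
/-- The term `δ_k(s)`. -/
def tDelta (k : ℕ+) (s : Tm n) : Tm n := Functions.apply₁ (L := Lang) (Func.delta k) s
/-- The term `s + t`. -/
def tAdd (s t : Tm n) : Tm n := Functions.apply₂ (L := Lang) Func.add s t
/-- The term `s + ⋯ + s` with `k` summands. -/
def tMul (k : ℕ) (s : Tm n) : Tm n := (tAdd s)^[k] tZero
/-- The formula `s < t`. -/
def fLt (s t : Tm n) : Lang.BoundedFormula Empty n := Relations.boundedFormula₂ (L := Lang) Rel.lt s t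

/-- The axioms of `T_pdg*` other than those on the `δ_n` and on the values of `χ⁻¹` outside
`χ(Γ^{<0})`. -/
def baseAxioms : Set Lang.Sentence := {
  -- `<` is a strict linear order with greatest element `∞`
  ∀' ∼(fLt (&0) (&0)),
  ∀' ∀' ∀' (fLt (&0) (&1) ⟹ fLt (&1) (&2) ⟹ fLt (&0) (&2)),
  ∀' ∀' (fLt (&0) (&1) ⊔ (&0 =' &1) ⊔ fLt (&1) (&0)),
  ∀' (∼(&0 =' tInf) ⟹ fLt (&0) tInf),
  -- the elements other than `∞` form an ordered abelian group, and `∞` is absorbing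
  ∼(tZero =' tInf),
  ∀' ∀' (tAdd (&0) (&1) =' tAdd (&1) (&0)),
  ∀' ∀' ∀' (tAdd (tAdd (&0) (&1)) (&2) =' tAdd (&0) (tAdd (&1) (&2))),
  ∀' (tAdd (&0) tZero =' &0),
  ∀' (tAdd (&0) tInf =' tInf),
  ∀' (∼(&0 =' tInf) ⟹ (tAdd (&0) (tNeg (&0)) =' tZero)),
  tNeg tInf =' tInf,
  ∀' ∀' ∀' (fLt (&0) (&1) ⟹ ∼(&2 =' tInf) ⟹ fLt (tAdd (&0) (&2)) (tAdd (&1) (&2))),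
  -- `χ` is a centripetal precontraction map
  tChi tInf =' tInf,
  ∀' (∼(&0 =' tInf) ⟹ ∼(tChi (&0) =' tInf)),
  ∀' ((tChi (&0) =' tZero) ⇔ (&0 =' tZero)),
  ∀' ∀' (fLt (&0) (&1) ⟹ ∼(fLt (tChi (&1)) (tChi (&0)))),
  ∀' (tChi (tNeg (&0)) =' tNeg (tChi (&0))),
  ∀' (tChi (tAdd (&0) (&0)) =' tChi (&0)),
  ∀' (fLt (&0) tZero ⟹ fLt (&0) (tChi (&0))),
  -- `c` is the least element of `χ(Γ^{<0})`
  ∃' (fLt (&0) tZero ⊓ (tChi (&0) =' tC)),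
  ∀' (fLt (&0) tZero ⟹ ∼(fLt (tChi (&0)) tC)),
  -- `χ` is a bijection from `χ(Γ^{<0})` onto `χ(Γ^{<0})^{>c}`
  ∀' (fLt (&0) tZero ⟹ fLt tC (tChi (tChi (&0)))),
  ∀' ∀' (fLt (&0) tZero ⟹ fLt (&1) tZero ⟹ (tChi (tChi (&0)) =' tChi (tChi (&1))) ⟹
    (tChi (&0) =' tChi (&1))),
  ∀' (fLt (&0) tZero ⟹ fLt tC (tChi (&0)) ⟹
    ∃' (fLt (&1) tZero ⊓ (tChi (tChi (&1)) =' tChi (&0)))),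
  -- `χ` is the successor function of `χ(Γ^{<0})`
  ∀' ∀' (fLt (&0) tZero ⟹ fLt (&1) tZero ⟹ fLt (tChi (&0)) (tChi (&1)) ⟹
    (fLt (tChi (&0)) (tChi (tChi (&0))) ⊓ ∼(fLt (tChi (&1)) (tChi (tChi (&0)))))),
  -- `χ⁻¹` inverts this bijection, and fixes `0` and `∞`
  ∀' (fLt (&0) tZero ⟹ (tInv (tChi (tChi (&0))) =' tChi (&0))),
  tInv tZero =' tZero,
  tInv tInf =' tInf }

/-- The axiom saying that `δ_k` is division by `k`. -/
def deltaAxiom (k : ℕ+) : Lang.Sentence := ∀' (tMul k (tDelta k (&0)) =' &0)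

/-- The axioms on the values of `χ⁻¹` outside `χ(Γ^{<0})^{>c} ∪ {0, ∞}`. -/
def invAxioms : Convention → Set Lang.Sentence
  | .infty => {
      ∀' (∼(&0 =' tZero) ⟹ (∀' (fLt (&1) tZero ⟹ ∼(tChi (tChi (&1)) =' &0))) ⟹
        (tInv (&0) =' tInf)) }
  | .odd => {
      ∀' (tInv (tNeg (&0)) =' tNeg (tInv (&0))),
      ∀' (∼(&0 =' tZero) ⟹ (∀' (fLt (&1) tZero ⟹
        (∼(tChi (tChi (&1)) =' &0) ⊓ ∼(tChi (tChi (&1)) =' tNeg (&0))))) ⟹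
        (tInv (&0) =' tInf)) }

/-- The `L_pdg*`-theory `T_pdg*`, whose models are the expansions of the models of `T_pdg`
(see `models_iff_isExpansion`). -/
def TpdgStar (conv : Convention) : Lang.Theory :=
  baseAxioms ∪ Set.range deltaAxiom ∪ invAxioms conv

end Axioms

/-! ### The models of `T_pdg*` are the expansions of the models of `T_pdg` -/

section Models

open FirstOrder FirstOrder.Language

variable {M : Type u} [Lang.Structure M]

abbrev mZero (M : Type u) [Lang.Structure M] : M := Structure.funMap (L := Lang) Func.zero ![]
abbrev mC (M : Type u) [Lang.Structure M] : M := Structure.funMap (L := Lang) Func.c ![]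
abbrev mInf (M : Type u) [Lang.Structure M] : M := Structure.funMap (L := Lang) Func.infty ![]
abbrev mNeg (x : M) : M := Structure.funMap (L := Lang) Func.neg ![x]
abbrev mChi (x : M) : M := Structure.funMap (L := Lang) Func.chi ![x]
abbrev mInv (x : M) : M := Structure.funMap (L := Lang) Func.chiInv ![x]
abbrev mDelta (k : ℕ+) (x : M) : M := Structure.funMap (L := Lang) (Func.delta k) ![x]
abbrev mAdd (x y : M) : M := Structure.funMap (L := Lang) Func.add ![x, y]
abbrev mLt (x y : M) : Prop := Structure.RelMap (L := Lang) Rel.lt ![x, y]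

/-- The meaning of the axioms of `T_pdg*` in a structure. -/
structure Holds (conv : Convention) (M : Type u) [Lang.Structure M] : Prop where
  irrefl : ∀ x : M, ¬ mLt x x
  trans : ∀ x y z : M, mLt x y → mLt y z → mLt x z
  total : ∀ x y : M, (mLt x y ∨ x = y) ∨ mLt y x
  lt_inf : ∀ x : M, x ≠ mInf M → mLt x (mInf M)
  zero_ne : mZero M ≠ mInf M
  comm : ∀ x y : M, mAdd x y = mAdd y x
  assoc : ∀ x y z : M, mAdd (mAdd x y) z = mAdd x (mAdd y z)
  add_zero : ∀ x : M, mAdd x (mZero M) = x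
  add_inf : ∀ x : M, mAdd x (mInf M) = mInf M
  add_neg : ∀ x : M, x ≠ mInf M → mAdd x (mNeg x) = mZero M
  neg_inf : mNeg (mInf M) = mInf M
  add_lt : ∀ x y z : M, mLt x y → z ≠ mInf M → mLt (mAdd x z) (mAdd y z)
  chi_inf : mChi (mInf M) = mInf M
  chi_ne : ∀ x : M, x ≠ mInf M → mChi x ≠ mInf M
  chi_zero : ∀ x : M, mChi x = mZero M ↔ x = mZero M
  chi_mono : ∀ x y : M, mLt x y → ¬ mLt (mChi y) (mChi x)
  chi_neg : ∀ x : M, mChi (mNeg x) = mNeg (mChi x)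
  chi_double : ∀ x : M, mChi (mAdd x x) = mChi x
  centripetal : ∀ x : M, mLt x (mZero M) → mLt x (mChi x)
  c_mem : ∃ x : M, mLt x (mZero M) ∧ mChi x = mC M
  c_le : ∀ x : M, mLt x (mZero M) → ¬ mLt (mChi x) (mC M)
  maps : ∀ x : M, mLt x (mZero M) → mLt (mC M) (mChi (mChi x))
  inj : ∀ x y : M, mLt x (mZero M) → mLt y (mZero M) → mChi (mChi x) = mChi (mChi y) →
    mChi x = mChi y
  surj : ∀ x : M, mLt x (mZero M) → mLt (mC M) (mChi x) →
    ∃ y : M, mLt y (mZero M) ∧ mChi (mChi y) = mChi x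
  succ : ∀ x y : M, mLt x (mZero M) → mLt y (mZero M) → mLt (mChi x) (mChi y) →
    mLt (mChi x) (mChi (mChi x))
  succ_le : ∀ x y : M, mLt x (mZero M) → mLt y (mZero M) → mLt (mChi x) (mChi y) →
    ¬ mLt (mChi y) (mChi (mChi x))
  inv_chi : ∀ x : M, mLt x (mZero M) → mInv (mChi (mChi x)) = mChi x
  inv_zero : mInv (mZero M) = mZero M
  inv_inf : mInv (mInf M) = mInf M
  delta : ∀ (k : ℕ+) (x : M), (mAdd (mDelta k x))^[(k : ℕ)] (mZero M) = x
  inv_infty : conv = .infty → ∀ y : M, y ≠ mZero M →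
    (∀ x : M, mLt x (mZero M) → mChi (mChi x) ≠ y) → mInv y = mInf M
  inv_odd : conv = .odd → (∀ y : M, mInv (mNeg y) = mNeg (mInv y)) ∧ ∀ y : M, y ≠ mZero M →
    (∀ x : M, mLt x (mZero M) → mChi (mChi x) ≠ y) →
    (∀ x : M, mLt x (mZero M) → mChi (mChi x) ≠ mNeg y) → mInv y = mInf M

section realize
variable {n : ℕ} (v : Empty → M) (xs : Fin n → M) (s t : Tm n)

theorem r_zero : (tZero : Tm n).realize (Sum.elim v xs) = mZero M := by
  exact congrArg (Structure.funMap (L := Lang) Func.zero) (Subsingleton.elim _ _)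
theorem r_c : (tC : Tm n).realize (Sum.elim v xs) = mC M := by
  exact congrArg (Structure.funMap (L := Lang) Func.c) (Subsingleton.elim _ _)
theorem r_inf : (tInf : Tm n).realize (Sum.elim v xs) = mInf M := by
  exact congrArg (Structure.funMap (L := Lang) Func.infty) (Subsingleton.elim _ _)
theorem r_neg : (tNeg s).realize (Sum.elim v xs) = mNeg (s.realize (Sum.elim v xs)) :=
  Term.realize_functions_apply₁
theorem r_chi : (tChi s).realize (Sum.elim v xs) = mChi (s.realize (Sum.elim v xs)) :=
  Term.realize_functions_apply₁
theorem r_inv : (tInv s).realize (Sum.elim v xs) = mInv (s.realize (Sum.elim v xs)) :=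
  Term.realize_functions_apply₁
theorem r_delta (k : ℕ+) :
    (tDelta k s).realize (Sum.elim v xs) = mDelta k (s.realize (Sum.elim v xs)) :=
  Term.realize_functions_apply₁
theorem r_add : (tAdd s t).realize (Sum.elim v xs) =
    mAdd (s.realize (Sum.elim v xs)) (t.realize (Sum.elim v xs)) :=
  Term.realize_functions_apply₂
theorem r_mul (k : ℕ) : (tMul k s).realize (Sum.elim v xs) =
    (mAdd (s.realize (Sum.elim v xs)))^[k] (mZero M) := by
  induction k with
  | zero => simp [tMul, r_zero]
  | succ k ih =>
    rw [tMul, Function.iterate_succ_apply'] at *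
    rw [r_add, ih, Function.iterate_succ_apply']
theorem r_lt : (fLt s t).Realize v xs ↔
    mLt (s.realize (Sum.elim v xs)) (t.realize (Sum.elim v xs)) :=
  BoundedFormula.realize_rel₂

end realize

theorem models_iff_holds (conv : Convention) : M ⊨ TpdgStar conv ↔ Holds conv M := by
  have e10 : ∀ (a : M) (x : Fin 0 → M), (Fin.snoc x a : Fin 1 → M) 0 = a := fun _ _ => rfl
  have e20 : ∀ (a b : M) (x : Fin 0 → M),
      (Fin.snoc (Fin.snoc x a : Fin 1 → M) b : Fin 2 → M) 0 = a := fun _ _ _ => rfl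
  have e21 : ∀ (a b : M) (x : Fin 0 → M),
      (Fin.snoc (Fin.snoc x a : Fin 1 → M) b : Fin 2 → M) 1 = b := fun _ _ _ => rfl
  have e30 : ∀ (a b c : M) (x : Fin 0 → M), (Fin.snoc (Fin.snoc (Fin.snoc x a : Fin 1 → M) b :
      Fin 2 → M) c : Fin 3 → M) 0 = a := fun _ _ _ _ => rfl
  have e31 : ∀ (a b c : M) (x : Fin 0 → M), (Fin.snoc (Fin.snoc (Fin.snoc x a : Fin 1 → M) b :
      Fin 2 → M) c : Fin 3 → M) 1 = b := fun _ _ _ _ => rfl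
  have e32 : ∀ (a b c : M) (x : Fin 0 → M), (Fin.snoc (Fin.snoc (Fin.snoc x a : Fin 1 → M) b :
      Fin 2 → M) c : Fin 3 → M) 2 = c := fun _ _ _ _ => rfl
  cases conv <;>
  · simp only [Theory.model_iff, TpdgStar, baseAxioms, invAxioms, deltaAxiom, Set.mem_union,
      or_imp, forall_and, Set.mem_insert_iff, Set.mem_singleton_iff, forall_eq, Set.mem_range,
      forall_exists_index, forall_apply_eq_imp_iff,
      Sentence.Realize, Formula.Realize, BoundedFormula.realize_all, BoundedFormula.realize_ex,
      BoundedFormula.realize_imp, BoundedFormula.realize_not, BoundedFormula.realize_sup,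
      BoundedFormula.realize_inf, BoundedFormula.realize_iff, BoundedFormula.realize_bdEqual,
      r_lt, r_zero, r_c, r_inf, r_neg, r_chi, r_inv, r_delta, r_add, r_mul, Term.realize_var,
      Sum.elim_inr, Function.comp_apply, e10, e20, e21, e30, e31, e32]
    constructor
    · rintro ⟨⟨⟨h1, h2, h3, h4, h5, h6, h7, h8, h9, h10, h11, h12, h13, h14, h15, h16, h17, h18, h19,
        h20, h21, h22, h23, h24, ⟨h25, h26⟩, h27, h28, h29⟩, h30⟩, h31⟩
      refine ⟨h1, h2, h3, h4, h5, h6, h7, h8, h9, h10, h11, h12, h13, h14, h15, h16, h17, h18, h19,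
        h20, h21, h22, h23, h24, h25, h26, h27, h28, h29, h30, ?_, ?_⟩
      · first | exact fun _ => h31 | exact fun h => nomatch h
      · first | exact fun _ => ⟨h31.1, fun y hy h h' => h31.2 y hy ⟨h, h'⟩⟩ | exact fun h => nomatch h
    · rintro ⟨h1, h2, h3, h4, h5, h6, h7, h8, h9, h10, h11, h12, h13, h14, h15, h16, h17, h18, h19,
        h20, h21, h22, h23, h24, h25, h26, h27, h28, h29, h30, h31, h32⟩
      refine ⟨⟨⟨h1, h2, h3, h4, h5, h6, h7, h8, h9, h10, h11, h12, h13, h14, h15, h16, h17, h18, h19,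
        h20, h21, h22, h23, h24, ⟨h25, h26⟩, h27, h28, h29⟩, h30⟩, ?_⟩
      first
        | exact h31 rfl
        | exact ⟨(h32 rfl).1, fun y hy h => (h32 rfl).2 y hy h.1 h.2⟩

section toModel

variable {Γ : Type u} [AddCommGroup Γ] [LinearOrder Γ] [IsOrderedAddMonoid Γ]

theorem chiInv_eq {conv : Convention} {χ : Γ → Γ} {c : Γ} (h : IsModel χ c) {b : Γ}
    (hb : b ∈ negImage χ) : chiInv conv χ (χ b : Γ) = b := by
  have : χ b ∈ χ '' negImage χ := ⟨b, hb, rfl⟩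
  simp only [chiInv, this, if_true]
  rw [h.bijOn.injOn.leftInvOn_invFunOn hb]

theorem divBy_spec {χ : Γ → Γ} {c : Γ} (h : IsModel χ c) (k : ℕ+) (a : Γ) :
    ∃ b : Γ, divBy k (a : WithTop Γ) = b ∧ (k : ℕ) • b = a :=
  ⟨_, rfl, Function.invFun_eq (h.divisible k k.pos a)⟩

theorem iterate_add {Γ : Type u} [AddCommGroup Γ] (k : ℕ) (b : Γ) :
    (fun x : WithTop Γ => (b : WithTop Γ) + x)^[k] 0 = ((k • b : Γ) : WithTop Γ) := by
  induction k with
  | zero => simp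
  | succ k ih => rw [Function.iterate_succ_apply', ih, succ_nsmul', WithTop.coe_add]

theorem holds_expansion (conv : Convention) {χ : Γ → Γ} {c : Γ} (h : IsModel χ c) :
    @Holds conv (WithTop Γ) (expansion conv χ c) := by
  have hχ0 : χ 0 = 0 := (h.eq_zero_iff 0).2 rfl
  have hneg : ∀ a, a < 0 → χ a < 0 := fun a ha =>
    lt_of_le_of_ne (hχ0 ▸ h.mono a 0 ha.le) fun e => ha.ne ((h.eq_zero_iff a).1 e)
  have hcoe : ∀ x : WithTop Γ, x ≠ ⊤ → ∃ a : Γ, x = a := fun x hx =>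
    ⟨x.untop hx, (WithTop.coe_untop x hx).symm⟩
  have hlt0 : ∀ x : WithTop Γ, x < 0 → ∃ a : Γ, x = a ∧ a < 0 := fun x hx => by
    obtain ⟨a, rfl⟩ := hcoe x (ne_top_of_lt hx)
    exact ⟨a, rfl, by exact_mod_cast hx⟩
  have himg : ∀ a, a < 0 → χ a ∈ negImage χ := fun a ha => ⟨a, ha, rfl⟩
  have hS : ∀ a ∈ χ '' negImage χ, a < 0 := by
    rintro _ ⟨_, ⟨a, ha, rfl⟩, rfl⟩
    exact hneg _ (hneg _ ha)
  have hout : ∀ (a : Γ), (∀ x : WithTop Γ, x < 0 → WithTop.map χ (WithTop.map χ x) ≠ a) →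
      a ∉ χ '' negImage χ := by
    rintro _ hx ⟨_, ⟨b, hb, rfl⟩, rfl⟩
    exact hx b (WithTop.coe_lt_coe.2 hb) rfl
  refine @Holds.mk conv (WithTop Γ) (expansion conv χ c) ?_ ?_ ?_ ?_ ?_ ?_ ?_ ?_ ?_ ?_ ?_ ?_ ?_ ?_ ?_ ?_ ?_ ?_ ?_ ?_
    ?_ ?_ ?_ ?_ ?_ ?_ ?_ ?_ ?_ ?_ ?_ ?_
  · exact fun x => lt_irrefl (α := WithTop Γ) x
  · exact fun x y z => lt_trans (α := WithTop Γ)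
  · exact fun x y => by
      rcases lt_trichotomy (α := WithTop Γ) x y with h | h | h
      exacts [.inl (.inl h), .inl (.inr h), .inr h]
  · exact fun x hx => lt_top_iff_ne_top.2 hx
  · exact WithTop.coe_ne_top (a := (0 : Γ))
  · exact fun x y => add_comm (G := WithTop Γ) x y
  · exact fun x y z => add_assoc (G := WithTop Γ) x y z
  · exact fun x => add_zero (M := WithTop Γ) x
  · exact fun x => WithTop.add_top x
  · intro x hx
    obtain ⟨a, rfl⟩ := hcoe x hx
    change ((a + -a : Γ) : WithTop Γ) = ((0 : Γ) : WithTop Γ)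
    rw [add_neg_cancel]
  · rfl
  · intro x y z hxy hz
    obtain ⟨a, rfl⟩ := hcoe z hz
    change x < y at hxy
    obtain ⟨b, rfl⟩ := hcoe x (ne_top_of_lt hxy)
    change (b + a : WithTop Γ) < y + a
    cases y with
    | top => rw [WithTop.top_add]; exact WithTop.coe_lt_top (b + a)
    | coe y =>
      have : b < y := by exact_mod_cast hxy
      exact_mod_cast add_lt_add_left this a
  · rfl
  · intro x hx
    obtain ⟨a, rfl⟩ := hcoe x hx
    exact WithTop.coe_ne_top (a := χ a)
  · intro x
    cases x with
    | top => exact Iff.rfl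
    | coe a =>
      change ((χ a : Γ) : WithTop Γ) = ((0 : Γ) : WithTop Γ) ↔ (a : WithTop Γ) = ((0 : Γ) : WithTop Γ)
      rw [WithTop.coe_eq_coe, WithTop.coe_eq_coe]
      exact h.eq_zero_iff a
  · intro x y hxy
    change x < y at hxy
    obtain ⟨b, rfl⟩ := hcoe x (ne_top_of_lt hxy)
    cases y with
    | top => exact not_top_lt (α := WithTop Γ)
    | coe y =>
      have hby : b < y := by exact_mod_cast hxy
      exact not_lt.2 (WithTop.coe_le_coe.2 (h.mono b y hby.le))
  · intro x
    cases x with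
    | top => rfl
    | coe a => exact congrArg (WithTop.some) (h.map_neg a)
  · intro x
    cases x with
    | top => rfl
    | coe a =>
      refine congrArg (WithTop.some) (h.arch _ _ ?_ ?_)
      · refine ArchimedeanClass.mk_eq_mk.2 ⟨⟨1, ?_⟩, ⟨2, ?_⟩⟩
        · change |a| ≤ 1 • |a + a|
          rw [one_nsmul, ← two_nsmul, abs_nsmul, two_nsmul]
          exact le_add_of_nonneg_left (abs_nonneg a)
        · rw [two_nsmul]; exact abs_add_le a a
      · rcases lt_trichotomy a 0 with ha | rfl | ha
        · rw [sign_neg ha, sign_neg (add_neg ha ha)]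
        · simp
        · rw [sign_pos ha, sign_pos (add_pos ha ha)]
  · intro x hx
    obtain ⟨a, rfl, ha⟩ := hlt0 x hx
    have := h.centripetal a ha.ne
    rw [abs_of_neg ha, abs_of_neg (hneg a ha)] at this
    exact WithTop.coe_lt_coe.2 (neg_lt_neg_iff.1 this)
  · obtain ⟨a, ha, e⟩ := h.isLeast.1
    exact ⟨(a : WithTop Γ), WithTop.coe_lt_coe.2 ha, congrArg WithTop.some e⟩
  · intro x hx
    obtain ⟨a, rfl, ha⟩ := hlt0 x hx
    exact not_lt.2 (WithTop.coe_le_coe.2 (h.isLeast.2 (himg a ha)))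
  · intro x hx
    obtain ⟨a, rfl, ha⟩ := hlt0 x hx
    exact WithTop.coe_lt_coe.2 (h.bijOn.mapsTo (himg a ha)).2
  · intro x y hx hy e
    obtain ⟨a, rfl, ha⟩ := hlt0 x hx
    obtain ⟨b, rfl, hb⟩ := hlt0 y hy
    exact congrArg WithTop.some (h.bijOn.injOn (himg a ha) (himg b hb) (WithTop.coe_eq_coe.1 e))
  · intro x hx hc
    obtain ⟨a, rfl, ha⟩ := hlt0 x hx
    obtain ⟨_, ⟨b, hb, rfl⟩, e⟩ := h.bijOn.surjOn ⟨himg a ha, WithTop.coe_lt_coe.1 hc⟩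
    exact ⟨(b : WithTop Γ), WithTop.coe_lt_coe.2 hb, congrArg WithTop.some e⟩
  · intro x y hx hy hl
    obtain ⟨a, rfl, ha⟩ := hlt0 x hx
    obtain ⟨b, rfl, hb⟩ := hlt0 y hy
    exact WithTop.coe_lt_coe.2 (h.succ _ (himg a ha) _ (himg b hb) (WithTop.coe_lt_coe.1 hl)).1
  · intro x y hx hy hl
    obtain ⟨a, rfl, ha⟩ := hlt0 x hx
    obtain ⟨b, rfl, hb⟩ := hlt0 y hy
    exact not_lt.2 (WithTop.coe_le_coe.2
      (h.succ _ (himg a ha) _ (himg b hb) (WithTop.coe_lt_coe.1 hl)).2)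
  · intro x hx
    obtain ⟨a, rfl, ha⟩ := hlt0 x hx
    exact chiInv_eq h (himg a ha)
  · change chiInv conv χ ((0 : Γ) : WithTop Γ) = 0
    have : (0 : Γ) ∉ χ '' negImage χ := fun h0 => (hS 0 h0).false
    simp only [chiInv, this, if_false, if_true]
  · rfl
  · intro k x
    cases x with
    | top =>
      change (fun x : WithTop Γ => (⊤ : WithTop Γ) + x)^[(k : ℕ)] 0 = ⊤
      obtain ⟨m, hm⟩ := Nat.exists_eq_succ_of_ne_zero k.ne_zero
      rw [hm, Function.iterate_succ_apply']; exact WithTop.top_add _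
    | coe a =>
      obtain ⟨b, hb, e⟩ := divBy_spec h k a
      change (fun x : WithTop Γ => divBy k (a : WithTop Γ) + x)^[(k : ℕ)] 0 = _
      rw [hb, iterate_add, e]
  · rintro rfl y hy hx
    cases y with
    | top => rfl
    | coe a =>
      have h1 := hout a hx
      have h2 : a ≠ 0 := fun e => hy (congrArg WithTop.some e)
      change chiInv .infty χ (a : WithTop Γ) = ⊤
      simp only [chiInv, h1, h2, if_false]
  · rintro rfl
    constructor
    · intro y
      cases y with
      | top => rfl
      | coe a =>
        change chiInv .odd χ ((-a : Γ) : WithTop Γ) =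
          WithTop.map (fun a : Γ => -a) (chiInv .odd χ (a : WithTop Γ))
        by_cases h1 : a ∈ χ '' negImage χ
        · have h2 : -a ∉ χ '' negImage χ := fun h' =>
            (hS _ h').not_gt (neg_pos.2 (hS _ h1))
          have h3 : a ≠ 0 := (hS _ h1).ne
          simp [chiInv, h1, h2, h3]
        · by_cases h3 : a = 0
          · subst h3
            have : (0 : Γ) ∉ χ '' negImage χ := h1
            simp only [chiInv, neg_zero, this, if_false, if_true]
            exact congrArg WithTop.some neg_zero.symm
          · by_cases h2 : -a ∈ χ '' negImage χ
            · simp only [chiInv, h1, h2, h3, if_true, if_false, WithTop.map_coe, neg_neg]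
            · simp [chiInv, h1, h2, h3]
    · intro y hy hx hx'
      cases y with
      | top => rfl
      | coe a =>
        have h1 := hout a hx
        have h3 := hout (-a) hx'
        have h2 : a ≠ 0 := fun e => hy (congrArg WithTop.some e)
        change chiInv .odd χ (a : WithTop Γ) = ⊤
        simp only [chiInv, h1, h2, h3, if_false]

end toModel

theorem Holds.isExpansion {conv : Convention} (H : Holds conv M) : IsExpansion conv M := by
  classical
  have addFin : ∀ x y : M, x ≠ mInf M → y ≠ mInf M → mAdd x y ≠ mInf M := by
    intro x y hx hy e
    have h1 : mAdd (mNeg x) (mAdd x y) = y := by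
      rw [← H.assoc, H.comm (mNeg x) x, H.add_neg x hx, H.comm, H.add_zero]
    rw [e, H.add_inf] at h1
    exact hy h1.symm
  have negFin : ∀ x : M, x ≠ mInf M → mNeg x ≠ mInf M := by
    intro x hx e
    have h1 := H.add_neg x hx
    rw [e, H.add_inf] at h1
    exact H.zero_ne h1.symm
  have ltFin : ∀ x y : M, mLt x y → x ≠ mInf M := by
    rintro x y h rfl
    by_cases hy : y = mInf M
    · subst hy; exact H.irrefl _ h
    · exact H.irrefl _ (H.trans _ _ _ h (H.lt_inf y hy))
  have cFin : mC M ≠ mInf M := by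
    obtain ⟨x, hx, e⟩ := H.c_mem
    exact e ▸ H.chi_ne x (ltFin _ _ hx)
  let Γ : Type u := {x : M // x ≠ mInf M}
  let _ : Zero Γ := ⟨⟨mZero M, H.zero_ne⟩⟩
  let _ : Add Γ := ⟨fun x y => ⟨mAdd x.1 y.1, addFin _ _ x.2 y.2⟩⟩
  let _ : Neg Γ := ⟨fun x => ⟨mNeg x.1, negFin _ x.2⟩⟩
  let iG : AddCommGroup Γ :=
    { add_assoc := fun a b c => Subtype.ext (H.assoc _ _ _)
      zero_add := fun a => Subtype.ext ((H.comm _ _).trans (H.add_zero _))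
      add_zero := fun a => Subtype.ext (H.add_zero _)
      nsmul := nsmulRec
      zsmul := zsmulRec
      neg_add_cancel := fun a => Subtype.ext ((H.comm _ _).trans (H.add_neg _ a.2))
      add_comm := fun a b => Subtype.ext (H.comm _ _) }
  let iL : LinearOrder Γ :=
    { lt := fun x y => mLt x.1 y.1
      le := fun x y => x = y ∨ mLt x.1 y.1
      le_refl := fun x => .inl rfl
      le_trans := by
        rintro x y z (rfl | h) (rfl | h')
        exacts [.inl rfl, .inr h', .inr h, .inr (H.trans _ _ _ h h')]
      le_antisymm := by
        rintro x y (rfl | h) (h' | h')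
        exacts [rfl, rfl, h'.symm, (H.irrefl _ (H.trans _ _ _ h h')).elim]
      lt_iff_le_not_ge := by
        intro x y
        constructor
        · intro h
          refine ⟨.inr h, ?_⟩
          rintro (rfl | h')
          exacts [H.irrefl _ h, H.irrefl _ (H.trans _ _ _ h h')]
        · rintro ⟨rfl | h, h'⟩
          exacts [(h' (.inl rfl)).elim, h]
      le_total := by
        intro x y
        rcases H.total x.1 y.1 with (h | h) | h
        exacts [.inl (.inr h), .inl (.inl (Subtype.ext h)), .inr (.inr h)]
      toDecidableLE := Classical.decRel _ }
  have iO : IsOrderedAddMonoid Γ :=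
    { add_le_add_left := by
        rintro a b (rfl | h) c
        · exact le_refl _
        · exact .inr (H.add_lt _ _ _ h c.2) }
  let χ : Γ → Γ := fun x => ⟨mChi x.1, H.chi_ne _ x.2⟩
  let c : Γ := ⟨mC M, cFin⟩
  have zeroIff : ∀ a : Γ, χ a = 0 ↔ a = 0 := fun a =>
    ⟨fun h => Subtype.ext ((H.chi_zero a.1).1 (congrArg Subtype.val h)),
      fun h => Subtype.ext ((H.chi_zero a.1).2 (congrArg Subtype.val h))⟩
  have mono : ∀ a b : Γ, a ≤ b → χ a ≤ χ b := by
    intro a b hab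
    rcases hab.eq_or_lt with rfl | h
    · exact le_refl _
    · exact not_lt.1 (H.chi_mono a.1 b.1 h)
  have mapNeg : ∀ a : Γ, χ (-a) = -χ a := fun a => Subtype.ext (H.chi_neg a.1)
  have dbl : ∀ a : Γ, χ (a + a) = χ a := fun a => Subtype.ext (H.chi_double a.1)
  have pow : ∀ (k : ℕ) (a : Γ), χ (2 ^ k • a) = χ a := by
    intro k a
    induction k with
    | zero => simp
    | succ k ih => rw [pow_succ, mul_comm, mul_nsmul', two_nsmul, dbl, ih]
  have archLe : ∀ (m : ℕ) (a b : Γ), 0 < a → b ≤ m • a → χ b ≤ χ a := by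
    intro m a b ha hb
    rw [← pow m a]
    exact mono _ _ (hb.trans (nsmul_le_nsmul_left ha.le Nat.lt_two_pow_self.le))
  have archPos : ∀ a b : Γ, 0 < a → 0 < b → ArchimedeanClass.mk a = ArchimedeanClass.mk b →
      χ a = χ b := by
    intro a b ha hb hab
    obtain ⟨⟨m, hm⟩, ⟨n, hn⟩⟩ := ArchimedeanClass.mk_eq_mk.1 hab
    rw [abs_of_pos ha, abs_of_pos hb] at hm hn
    exact le_antisymm (archLe n b a hb hn) (archLe m a b ha hm)
  have χ0 : χ 0 = 0 := (zeroIff 0).2 rfl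
  have χneg : ∀ a : Γ, a < 0 → χ a < 0 := fun a ha =>
    lt_of_le_of_ne (χ0 ▸ mono a 0 ha.le) fun e => ha.ne ((zeroIff a).1 e)
  have cent : ∀ a : Γ, a < 0 → a < χ a := fun a ha => H.centripetal a.1 ha
  have centAbs : ∀ a : Γ, a < 0 → |χ a| < |a| := fun a ha => by
    rw [abs_of_neg ha, abs_of_neg (χneg a ha)]
    exact neg_lt_neg (cent a ha)
  have hdiv : ∀ (k : ℕ+) (x : M) (hx : x ≠ mInf M), ∃ b : Γ, b.1 = mDelta k x ∧
      (k : ℕ) • b = ⟨x, hx⟩ := by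
    intro k x hx
    have hb : mDelta k x ≠ mInf M := by
      intro e
      have h1 := H.delta k x
      obtain ⟨m, hm⟩ := Nat.exists_eq_succ_of_ne_zero k.ne_zero
      rw [hm, Function.iterate_succ_apply', e, H.comm, H.add_inf] at h1
      exact hx h1.symm
    have hit : ∀ j : ℕ, ((j • (⟨_, hb⟩ : Γ) : Γ) : M) = (mAdd (mDelta k x))^[j] (mZero M) := by
      intro j
      induction j with
      | zero => rw [zero_nsmul]; rfl
      | succ j ih => rw [succ_nsmul', Function.iterate_succ_apply', ← ih]; rfl
    exact ⟨⟨_, hb⟩, rfl, Subtype.ext ((hit k).trans (H.delta k x))⟩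
  have hM : IsModel χ c :=
    { eq_zero_iff := zeroIff
      mono := mono
      map_neg := mapNeg
      arch := by
        intro a b hab hs
        rcases lt_trichotomy a 0 with ha | rfl | ha
        · rw [sign_neg ha] at hs
          have hb : b < 0 := sign_eq_neg_one_iff.1 hs.symm
          have h1 := archPos (-a) (-b) (neg_pos.2 ha) (neg_pos.2 hb) (by simpa using hab)
          rw [mapNeg, mapNeg] at h1
          exact neg_injective h1
        · rw [sign_zero] at hs
          rw [sign_eq_zero_iff.1 hs.symm]
        · rw [sign_pos ha] at hs
          exact archPos a b ha (sign_eq_one_iff.1 hs.symm) hab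
      centripetal := by
        intro a ha
        rcases lt_or_gt_of_ne ha with h | h
        · exact centAbs a h
        · have := centAbs (-a) (neg_neg_of_pos h)
          rwa [mapNeg, abs_neg, abs_neg] at this
      nontrivial := by
        obtain ⟨x, hx, -⟩ := H.c_mem
        exact ⟨⟨x, ltFin _ _ hx⟩, 0, fun e => H.irrefl _ (by
          have : x = mZero M := congrArg Subtype.val e
          rwa [this] at hx)⟩
      isLeast := by
        constructor
        · obtain ⟨x, hx, e⟩ := H.c_mem
          exact ⟨⟨x, ltFin _ _ hx⟩, hx, Subtype.ext e⟩
        · rintro _ ⟨a, ha, rfl⟩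
          exact not_lt.1 (H.c_le a.1 ha)
      bijOn := by
        refine ⟨?_, ?_, ?_⟩
        · rintro _ ⟨a, ha, rfl⟩
          exact ⟨⟨χ a, χneg a ha, rfl⟩, H.maps a.1 ha⟩
        · rintro _ ⟨a, ha, rfl⟩ _ ⟨b, hb, rfl⟩ e
          exact Subtype.ext (H.inj a.1 b.1 ha hb (congrArg Subtype.val e))
        · rintro _ ⟨⟨a, ha, rfl⟩, hc⟩
          obtain ⟨y, hy, e⟩ := H.surj a.1 ha hc
          exact ⟨χ ⟨y, ltFin _ _ hy⟩, ⟨_, hy, rfl⟩, Subtype.ext e⟩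
      succ := by
        rintro _ ⟨a, ha, rfl⟩ _ ⟨b, hb, rfl⟩ hl
        exact ⟨H.succ a.1 b.1 ha hb hl, not_lt.1 (H.succ_le a.1 b.1 ha hb hl)⟩
      divisible := by
        intro n hn a
        obtain ⟨b, -, hb⟩ := hdiv ⟨n, hn⟩ a.1 a.2
        exact ⟨b, hb⟩ }
  refine ⟨Γ, iG, iL, iO, χ, c, hM, ?_⟩
  let S := expansion conv χ c
  let g : WithTop Γ → M := fun x => match x with
    | ⊤ => mInf M
    | (a : Γ) => a.1
  let f : M → WithTop Γ := fun x => if hx : x = mInf M then ⊤ else ((⟨x, hx⟩ : Γ) : WithTop Γ)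
  have fg : ∀ x, f (g x) = x := by
    intro x
    cases x with
    | top => exact dif_pos rfl
    | coe a => exact dif_neg a.2
  have gf : ∀ x, g (f x) = x := by
    intro x
    by_cases hx : x = mInf M
    · simp only [f, hx, dif_pos]; rfl
    · simp only [f, hx, dif_neg, not_false_eq_true]; rfl
  have gneg : ∀ x : WithTop Γ, g (WithTop.map (fun a : Γ => -a) x) = mNeg (g x) := by
    intro x
    cases x with
    | top => exact H.neg_inf.symm
    | coe a => rfl
  have gInv : ∀ x, g (chiInv conv χ x) = mInv (g x) := by
    have base : ∀ a ∈ χ '' negImage χ, chiInv conv χ (a : WithTop Γ) =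
        (Function.invFunOn χ (negImage χ) a : Γ) := fun a ha => by simp only [chiInv, ha, if_true]
    have baseM : ∀ a ∈ χ '' negImage χ, (Function.invFunOn χ (negImage χ) a).1 = mInv a.1 := by
      rintro _ ⟨_, ⟨b, hb, rfl⟩, rfl⟩
      rw [hM.bijOn.injOn.leftInvOn_invFunOn ⟨b, hb, rfl⟩]
      exact (H.inv_chi b.1 hb).symm
    have hout : ∀ a : Γ, a ∉ χ '' negImage χ →
        ∀ x : M, mLt x (mZero M) → mChi (mChi x) ≠ a.1 := by
      intro a ha x hx e
      exact ha ⟨χ ⟨x, ltFin _ _ hx⟩, ⟨_, hx, rfl⟩, Subtype.ext e⟩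
    intro x
    cases x with
    | top => exact H.inv_inf.symm
    | coe a =>
      by_cases h1 : a ∈ χ '' negImage χ
      · rw [base a h1]; exact baseM a h1
      · by_cases h2 : a = 0
        · subst h2
          have : chiInv conv χ ((0 : Γ) : WithTop Γ) = ((0 : Γ) : WithTop Γ) := by
            simp only [chiInv, h1, if_false, if_true]; rfl
          rw [this]
          exact H.inv_zero.symm
        · have h2' : a.1 ≠ mZero M := fun e => h2 (Subtype.ext e)
          cases conv with
          | infty =>
            have : chiInv .infty χ (a : WithTop Γ) = ⊤ := by
              simp only [chiInv, h1, h2, if_false]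
            rw [this]
            exact (H.inv_infty rfl a.1 h2' (hout a h1)).symm
          | odd =>
            by_cases h3 : -a ∈ χ '' negImage χ
            · have : chiInv .odd χ (a : WithTop Γ) =
                  ((-Function.invFunOn χ (negImage χ) (-a) : Γ) : WithTop Γ) := by
                simp only [chiInv, h1, h2, h3, if_false, if_true]
              rw [this]
              change mNeg (Function.invFunOn χ (negImage χ) (-a)).1 = mInv a.1
              rw [baseM _ h3, ← (H.inv_odd rfl).1]
              exact congrArg (fun z : Γ => mInv z.1) (neg_neg a)
            · have : chiInv .odd χ (a : WithTop Γ) = ⊤ := by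
                simp only [chiInv, h1, h2, h3, if_false]
              rw [this]
              exact ((H.inv_odd rfl).2 a.1 h2' (hout a h1) (hout (-a) h3)).symm
  have gdelta : ∀ (k : ℕ+) (x : WithTop Γ), g (divBy k x) = mDelta k (g x) := by
    intro k x
    cases x with
    | top =>
      change mInf M = mDelta k (mInf M)
      by_contra hne
      have h1 : ∀ j : ℕ, (mAdd (mDelta k (mInf M)))^[j] (mZero M) ≠ mInf M := by
        intro j
        induction j with
        | zero => exact H.zero_ne
        | succ j ih => rw [Function.iterate_succ_apply']; exact addFin _ _ (Ne.symm hne) ih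
      exact h1 k (H.delta k (mInf M))
    | coe a =>
      obtain ⟨b, hb, e⟩ := hdiv k a.1 a.2
      obtain ⟨b', hb', e'⟩ := divBy_spec hM k a
      rw [hb']
      have : b' = b := nsmul_right_injective k.ne_zero (e'.trans e.symm)
      rw [this]
      exact hb
  have gchi : ∀ x : WithTop Γ, g (WithTop.map χ x) = mChi (g x) := by
    intro x
    cases x with
    | top => exact H.chi_inf.symm
    | coe a => rfl
  have gadd : ∀ x y : WithTop Γ, g (x + y) = mAdd (g x) (g y) := by
    intro x y
    cases x with
    | top => rw [WithTop.top_add]; exact ((H.comm _ _).trans (H.add_inf _)).symm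
    | coe a =>
      cases y with
      | top => rw [WithTop.add_top]; exact (H.add_inf _).symm
      | coe b => rfl
  have glt : ∀ x y : WithTop Γ, mLt (g x) (g y) ↔ x < y := by
    intro x y
    cases x with
    | top => exact ⟨fun h => (ltFin _ _ h rfl).elim,
      fun h => (not_top_lt (α := WithTop Γ) h).elim⟩
    | coe a =>
      cases y with
      | top => exact ⟨fun _ => WithTop.coe_lt_top (α := Γ) a, fun _ => H.lt_inf _ a.2⟩
      | coe b => exact (WithTop.coe_lt_coe (α := Γ) (a := b) (b := a)).symm
  have vec0 : ∀ v : Fin 0 → WithTop Γ, g ∘ v = ![] := fun v => Subsingleton.elim _ _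
  have vec1 : ∀ v : Fin 1 → WithTop Γ, g ∘ v = ![g (v 0)] := fun v => by
    ext i; rw [Fin.eq_zero i]; rfl
  have vec2 : ∀ v : Fin 2 → WithTop Γ, g ∘ v = ![g (v 0), g (v 1)] := fun v => by
    ext i; fin_cases i <;> rfl
  let e : WithTop Γ ≃[Lang] M :=
    { toFun := g
      invFun := f
      left_inv := fg
      right_inv := gf
      map_fun' := by
        intro n F v
        cases F with
        | zero => rw [vec0]; rfl
        | c => rw [vec0]; rfl
        | infty => rw [vec0]; rfl
        | neg => rw [vec1]; exact gneg _
        | chi => rw [vec1]; exact gchi _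
        | chiInv => rw [vec1]; exact gInv _
        | delta k => rw [vec1]; exact gdelta k _
        | add => rw [vec2]; exact gadd _ _
      map_rel' := by
        intro n R v
        cases R with
        | lt => rw [vec2]; exact glt _ _ }
  exact ⟨e.symm⟩

/-- The models of `T_pdg*` are precisely the expansions of the models of `T_pdg`. -/
theorem models_iff_isExpansion (conv : Convention) (M : Type u) [Lang.Structure M] :
    M ⊨ TpdgStar conv ↔ IsExpansion conv M := by
  constructor
  · exact fun h => ((models_iff_holds conv).1 h).isExpansion
  · rintro ⟨Γ, _, _, _, χ, c, h, ⟨e⟩⟩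
    let _ := expansion conv χ c
    have : WithTop Γ ⊨ TpdgStar conv := (models_iff_holds conv).2 (holds_expansion conv h)
    exact FirstOrder.Language.StrongHomClass.theory_model e.symm

end Models

/-! ### Quantifier elimination -/

/-- The theory `T` has quantifier elimination: modulo `T`, every formula in the free variables
`x_0, …, x_(n-1)` is equivalent to a quantifier-free formula in the same variables. -/
def HasQE {L : FirstOrder.Language.{0, 0}} (T : L.Theory) : Prop :=
  ∀ (n : ℕ) (φ : L.Formula (Fin n)), ∃ ψ : L.Formula (Fin n),
    FirstOrder.Language.BoundedFormula.IsQF ψ ∧ T.Iff φ ψ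

end Pdg

/-! ### Countable saturation, compactness and an embedding test for quantifier elimination. -/

namespace FirstOrder.Language

open Cardinal

/-! Quantifier elimination reduces to an embedding test (`Theory.exists_isQF_of_embedding`): given a
countable model `M`, a countably saturated model `N` and tuples in them with the same atomic type,
some embedding of `M` into `N` carries one tuple to the other. Saturated models are obtained as
ultrapowers over `ℕ` (`countablySaturated_ultraproduct`).

Tuples of the same atomic type generate isomorphic substructures, so a partial isomorphism has to be
extended to all of `Γ`. The map `χ` behaves like a coarse valuation that remembers signs: it ignores
positive scalars, a sum has the value of its dominating summand (`IsPrecontraction.add_eq_right`),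
and `χ a` has the sign of `a`. Hence a `ℚ`-linear partial map that acts on values through a fixed
order embedding `e` (`IsCompatible`) preserves the order by itself.

The values are treated first. The set `D = χ(Γ^{<0})` is a discrete order with least element `c` and
successor map `χ`, so the conditions on the image of a new point are countably many weak
inequalities between iterates of `χ`. They are pairwise compatible, and saturation solves them
(`IsImageIso.exists_total`). The resulting map on `D` is extended oddly to `e`.

Then the group map is extended while `e` stays fixed. This is where `χ⁻¹` enters: if `d ∈ D` is not
in the domain, then `χ d` is not the value of any element `p` of the domain, because `χ⁻¹` would
recover `d` from it. So one of `d` and `p` dominates the other, and `d` can be sent to `e d`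
(`IsCompatible.exists_adjoin_image`). Any other element `b` needs an image `b'` with `χ' (b' - p') =
e (χ (b - p))` for all pairs `(p, p')` of the graph. Each such equation is an upper cut together
with a lower cut, so it suffices to solve two conditions at a time; this is the case distinction in
`IsValueMap.exists_pair`. The total map obtained in this way also respects `χ⁻¹`, including the
places where it is `∞` (`IsCompatible.isPartialIso_map`). -/

/-- A structure is countably saturated if every countable set of formulas in one variable with
parameters that is finitely satisfiable is satisfiable. -/
def CountablySaturated (L : Language.{0, 0}) (N : Type) [L.Structure N] : Prop :=
  ∀ φ : ℕ → L.Formula (N ⊕ Unit),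
    (∀ n, ∃ x : N, ∀ k < n, (φ k).Realize (Sum.elim id fun _ => x)) →
      ∃ x : N, ∀ k, (φ k).Realize (Sum.elim id fun _ => x)

/-- A diagonal argument. By Łoś, every finite part of the type is solvable in almost every factor.
In `M i` one solves as many of the first `i` formulas as possible; as the ultrafilter is
nonprincipal, this number exceeds any given `k` for almost all `i`. -/
theorem countablySaturated_ultraproduct (L : Language.{0, 0}) (M : ℕ → Type)
    [∀ i, L.Structure (M i)] [∀ i, Nonempty (M i)] :
    CountablySaturated L ((Filter.hyperfilter ℕ : Filter ℕ).Product M) := by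
  classical
  intro φ hφ
  let N := (Filter.hyperfilter ℕ : Filter ℕ).Product M
  let rep : N → ∀ i, M i := Quotient.out
  have hrep : ∀ a : N, ((rep a : ∀ i, M i) : N) = a := fun a => Quotient.out_eq a
  have los : ∀ (k : ℕ) (x : ∀ i, M i), (φ k).Realize (Sum.elim id fun _ => (x : N)) ↔
      ∀ᶠ i in (Filter.hyperfilter ℕ : Filter ℕ),
        (φ k).Realize (Sum.elim (fun a => rep a i) fun _ => x i) := by
    intro k x
    have h := Ultraproduct.realize_formula_cast (u := Filter.hyperfilter ℕ) (φ k)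
      (Sum.elim rep fun _ => x)
    have e1 : (fun i : N ⊕ Unit => ((Sum.elim rep (fun _ => x) i : ∀ i, M i) : N)) =
        Sum.elim id fun _ => (x : N) := by
      funext i
      rcases i with a | a
      · exact hrep a
      · rfl
    have e2 : ∀ j, (fun i : N ⊕ Unit => (Sum.elim rep (fun _ => x) i : ∀ i, M i) j) =
        Sum.elim (fun a => rep a j) fun _ => x j := by
      intro j
      funext i
      rcases i with a | a <;> rfl
    refine (iff_of_eq (congrArg (fun v => (φ k).Realize v) e1.symm)).trans (h.trans ?_)
    exact Filter.eventually_congr (Filter.Eventually.of_forall fun j =>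
      iff_of_eq (congrArg (fun v => (φ k).Realize v) (e2 j)))
  let good (i n : ℕ) : Prop := ∃ x : M i, ∀ k < n,
    (φ k).Realize (Sum.elim (fun a => rep a i) fun _ => x)
  have hgood : ∀ n, ∀ᶠ i in (Filter.hyperfilter ℕ : Filter ℕ), good i n := by
    intro n
    obtain ⟨x, hx⟩ := hφ n
    rw [← hrep x] at hx
    have h2 : ∀ᶠ i in (Filter.hyperfilter ℕ : Filter ℕ), ∀ k ∈ Finset.range n,
        (φ k).Realize (Sum.elim (fun a => rep a i) fun _ => rep x i) :=
      (Filter.eventually_all_finset _).2 fun k hk => (los k _).1 (hx k (Finset.mem_range.1 hk))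
    exact h2.mono fun i hi => ⟨rep x i, fun k hk => hi k (Finset.mem_range.2 hk)⟩
  have good0 : ∀ i, good i 0 := fun i => ⟨Classical.arbitrary _, fun k hk => absurd hk (by simp)⟩
  -- The bound `i` keeps the maximum finite even if all the formulas are solvable in `M i`.
  let m (i : ℕ) : ℕ := Nat.findGreatest (good i) i
  have hm : ∀ i, good i (m i) := fun i => Nat.findGreatest_spec (Nat.zero_le i) (good0 i)
  choose x hx using hm
  refine ⟨(x : N), fun k => (los k x).2 ?_⟩
  have hlarge : ∀ᶠ i in (Filter.hyperfilter ℕ : Filter ℕ), k + 1 ≤ i := by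
    have : ∀ᶠ i in Filter.atTop, k + 1 ≤ i := Filter.eventually_ge_atTop _
    exact Nat.hyperfilter_le_atTop this
  filter_upwards [hgood (k + 1), hlarge] with i h1 h2
  exact hx i k (Nat.lt_of_succ_le (Nat.le_findGreatest h2 h1))

variable {L : Language.{0, 0}}

/-- A compactness theorem for sets of formulas with free variables. -/
theorem Theory.exists_model_realize (T : L.Theory) {β : Type} (S : Set (L.Formula β))
    (h : ∀ S₀ : Finset (L.Formula β), (S₀ : Set (L.Formula β)) ⊆ S →
      ∃ (M : ModelType.{0, 0, 0} T) (v : β → M), ∀ φ ∈ S₀, φ.Realize v) :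
    ∃ (M : ModelType.{0, 0, 0} T) (v : β → M), ∀ φ ∈ S, φ.Realize v := by
  classical
  have hsat : ((L.lhomWithConstants β).onTheory T ∪ Formula.equivSentence '' S).IsSatisfiable := by
    rw [Theory.isSatisfiable_iff_isFinitelySatisfiable]
    intro T₀ hT₀
    let S₀ : Finset (L.Formula β) :=
      (T₀.image Formula.equivSentence.symm).filter fun φ => φ ∈ S
    obtain ⟨M, v, hv⟩ := h S₀ fun φ hφ => (Finset.mem_filter.1 hφ).2
    let _ : (constantsOn β).Structure M := constantsOn.structure v
    have hM : M ⊨ (L.lhomWithConstants β).onTheory T := (LHom.onTheory_model _ _).2 inferInstance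
    have : (M : Type) ⊨ (T₀ : L[[β]].Theory) := by
      refine (Theory.model_iff (M := M) (T₀ : L[[β]].Theory)).2 fun ψ hψ => ?_
      rcases hT₀ hψ with h1 | ⟨φ, hφ, rfl⟩
      · exact hM.realize_of_mem ψ h1
      · refine (Formula.realize_equivSentence M φ).2 (hv φ ?_)
        refine Finset.mem_filter.2 ⟨Finset.mem_image.2 ⟨_, hψ, ?_⟩, hφ⟩
        exact _root_.Equiv.symm_apply_apply _ _
    exact Theory.Model.isSatisfiable (M : Type)
  obtain ⟨M⟩ := hsat
  let _ := (L.lhomWithConstants β).reduct M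
  have hM := (Theory.model_iff _).1 M.is_model
  have : M ⊨ T := (LHom.onTheory_model (L.lhomWithConstants β) T).1
    ((Theory.model_iff _).2 fun φ hφ => hM φ (Or.inl hφ))
  refine ⟨Theory.ModelType.of T M, fun b => (L.con b : M), fun φ hφ => ?_⟩
  exact (Formula.realize_equivSentence M φ).1 (hM _ (Or.inr ⟨φ, hφ, rfl⟩))

/-- The tuples `v` in `M` and `w` in `N` satisfy the same atomic formulas. -/
structure SameAtomicType (L : Language.{0, 0}) {M N β : Type} [L.Structure M] [L.Structure N]
    (v : β → M) (w : β → N) : Prop where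
  eq_iff : ∀ s t : L.Term β, s.realize v = t.realize v ↔ s.realize w = t.realize w
  rel_iff : ∀ {k : ℕ} (R : L.Relations k) (t : Fin k → L.Term β),
    Structure.RelMap R (fun i => (t i).realize v) ↔ Structure.RelMap R fun i => (t i).realize w

/-- If tuples of the same quantifier-free type in models of `T` agree on the truth of `φ`, then `φ`
is equivalent to a quantifier-free formula modulo `T`. -/
theorem Theory.exists_isQF_of_preserved (T : L.Theory) {α : Type} {n : ℕ}
    (φ : L.BoundedFormula α n)
    (H : ∀ (M N : ModelType.{0, 0, 0} T) (v : α → M) (xs : Fin n → M) (w : α → N) (ys : Fin n → N),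
      (∀ ψ : L.BoundedFormula α n, ψ.IsQF → (ψ.Realize v xs ↔ ψ.Realize w ys)) →
        φ.Realize v xs → φ.Realize w ys) :
    ∃ ψ : L.BoundedFormula α n, ψ.IsQF ∧ T.Iff φ ψ := by
  classical
  by_contra hne
  -- Compactness works with formulas moved by `toFormula`; this recovers a finite list of original
  -- ones, whose conjunction can be formed.
  have conj : ∀ S₀ : Finset (L.Formula (α ⊕ Fin n)), ∀ P : L.BoundedFormula α n → Prop,
      (∀ ψ, P ψ → ψ.IsQF) → (∀ ψ ∈ S₀, ∃ ψ', P ψ' ∧ ψ = ψ'.toFormula) →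
      ∃ s : List (L.BoundedFormula α n), (∀ ψ ∈ s, P ψ) ∧
        ∀ ψ ∈ S₀, ∃ ψ' ∈ s, ψ = ψ'.toFormula := by
    intro S₀ P _ hP
    choose! g hg using hP
    exact ⟨S₀.toList.map g, by
      intro ψ hψ
      obtain ⟨θ, hθ, rfl⟩ := List.mem_map.1 hψ
      exact (hg θ (Finset.mem_toList.1 hθ)).1, fun ψ hψ =>
      ⟨g ψ, List.mem_map.2 ⟨ψ, Finset.mem_toList.2 hψ, rfl⟩, (hg ψ hψ).2⟩⟩
  have qfInf : ∀ s : List (L.BoundedFormula α n), (∀ ψ ∈ s, ψ.IsQF) →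
      (s.foldr (· ⊓ ·) ⊤ : L.BoundedFormula α n).IsQF := by
    intro s
    induction s with
    | nil => exact fun _ => BoundedFormula.IsQF.top
    | cons a s ih =>
      exact fun h => (h a (by simp)).inf (ih fun ψ hψ => h ψ (by simp [hψ]))
  -- a model of the quantifier-free consequences of `φ` in which `φ` fails
  let C : Set (L.BoundedFormula α n) := {ψ | ψ.IsQF ∧ T ⊨ᵇ φ.imp ψ}
  obtain ⟨N, w, hw⟩ := T.exists_model_realize
    (insert φ.not.toFormula {θ | ∃ ψ, ψ ∈ C ∧ θ = ψ.toFormula}) (by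
      intro S₀ hS₀
      by_contra hno
      obtain ⟨s, hs, hs'⟩ := conj (S₀.erase φ.not.toFormula) (· ∈ C) (fun ψ h => h.1) (by
        intro ψ hψ
        rcases hS₀ (Finset.mem_of_mem_erase hψ) with h | h
        · exact absurd h (Finset.ne_of_mem_erase hψ)
        · exact h)
      -- If `φ` never failed under these finitely many consequences, their conjunction would be
      -- equivalent to `φ`.
      refine hne ⟨s.foldr (· ⊓ ·) ⊤, qfInf s fun ψ hψ => (hs ψ hψ).1, ?_⟩
      intro M v xs
      rw [BoundedFormula.realize_iff, BoundedFormula.realize_foldr_inf]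
      refine ⟨fun hφ ψ hψ => (hs ψ hψ).2 M v xs hφ, fun hψ => ?_⟩
      by_contra hφ
      refine hno ⟨M, Sum.elim v xs, fun θ hθ => ?_⟩
      by_cases he : θ = φ.not.toFormula
      · subst he
        rw [BoundedFormula.realize_toFormula]
        exact hφ
      · obtain ⟨ψ, h1, rfl⟩ := hs' θ (Finset.mem_erase.2 ⟨he, hθ⟩)
        rw [BoundedFormula.realize_toFormula]
        exact hψ ψ h1)
  have hNφ : ¬ φ.Realize (w ∘ Sum.inl) (w ∘ Sum.inr) := by
    have := hw _ (Set.mem_insert _ _)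
    rw [BoundedFormula.realize_toFormula] at this
    exact this
  let Q : Set (L.BoundedFormula α n) :=
    {ψ | ψ.IsQF ∧ ψ.Realize (w ∘ Sum.inl) (w ∘ Sum.inr)}
  obtain ⟨M, v, hv⟩ := T.exists_model_realize
    (insert φ.toFormula {θ | ∃ ψ, ψ ∈ Q ∧ θ = ψ.toFormula}) (by
      intro S₀ hS₀
      by_contra hno
      obtain ⟨s, hs, hs'⟩ := conj (S₀.erase φ.toFormula) (· ∈ Q) (fun ψ h => h.1) (by
        intro ψ hψ
        rcases hS₀ (Finset.mem_of_mem_erase hψ) with h | h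
        · exact absurd h (Finset.ne_of_mem_erase hψ)
        · exact h)
      -- If `φ` is inconsistent with finitely many formulas true at `w`, the negation of their
      -- conjunction is a quantifier-free consequence of `φ`, hence also true at `w`, which is
      -- absurd.
      have hC : (s.foldr (· ⊓ ·) ⊤ : L.BoundedFormula α n).not ∈ C := by
        refine ⟨(qfInf s fun ψ hψ => (hs ψ hψ).1).not, fun M v xs hφ => ?_⟩
        refine (BoundedFormula.realize_not).2 fun hψ => ?_
        rw [BoundedFormula.realize_foldr_inf] at hψ
        refine hno ⟨M, Sum.elim v xs, fun θ hθ => ?_⟩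
        by_cases he : θ = φ.toFormula
        · subst he
          rw [BoundedFormula.realize_toFormula]
          exact hφ
        · obtain ⟨ψ, h1, rfl⟩ := hs' θ (Finset.mem_erase.2 ⟨he, hθ⟩)
          rw [BoundedFormula.realize_toFormula]
          exact hψ ψ h1
      have h1 := hw _ (Set.mem_insert_of_mem _ ⟨_, hC, rfl⟩)
      rw [BoundedFormula.realize_toFormula, BoundedFormula.realize_not,
        BoundedFormula.realize_foldr_inf] at h1
      exact h1 fun ψ hψ => (hs ψ hψ).2)
  refine hNφ (H M N (v ∘ Sum.inl) (v ∘ Sum.inr) _ _ (fun ψ hψ => ?_) ?_)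
  · have key : ∀ ψ : L.BoundedFormula α n, ψ.IsQF →
        ψ.Realize (w ∘ Sum.inl) (w ∘ Sum.inr) → ψ.Realize (v ∘ Sum.inl) (v ∘ Sum.inr) := by
      intro ψ hψ h
      have := hv _ (Set.mem_insert_of_mem _ ⟨ψ, ⟨hψ, h⟩, rfl⟩)
      rwa [BoundedFormula.realize_toFormula] at this
    refine ⟨fun h => ?_, key ψ hψ⟩
    by_contra h'
    exact key ψ.not hψ.not h' h
  · have := hv _ (Set.mem_insert _ _)
    rwa [BoundedFormula.realize_toFormula] at this

theorem sameAtomicType_of_isQF {M N α : Type} {n : ℕ} [L.Structure M] [L.Structure N]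
    {v : α → M} {xs : Fin n → M} {w : α → N} {ys : Fin n → N}
    (h : ∀ ψ : L.BoundedFormula α n, ψ.IsQF → (ψ.Realize v xs ↔ ψ.Realize w ys)) :
    SameAtomicType L (Sum.elim v xs) (Sum.elim w ys) where
  eq_iff s t := h (s.bdEqual t) (BoundedFormula.IsAtomic.equal s t).isQF
  rel_iff R t := h (R.boundedFormula t) (BoundedFormula.IsAtomic.rel R t).isQF

theorem exists_countable_elementarySubstructure (hL : L.card ≤ ℵ₀) (M : Type) [L.Structure M]
    (s : Set M) (hs : s.Countable) :
    ∃ S : L.ElementarySubstructure M, s ⊆ S ∧ Countable S := by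
  -- Downward Löwenheim–Skolem asks for at least `ℵ₀` elements; a countable `M` serves as its own
  -- substructure.
  rcases le_total #M ℵ₀ with h | h
  · have : Countable M := mk_le_aleph0_iff.1 h
    exact ⟨⊤, fun x _ => ElementarySubstructure.mem_top x, inferInstance⟩
  · obtain ⟨S, h1, h2⟩ := exists_elementarySubstructure_card_eq L s aleph0.{0} le_rfl
      (by simpa using hs.le_aleph0) (by simpa using hL) (by simpa using h)
    refine ⟨S, h1, mk_le_aleph0_iff.1 ?_⟩
    simpa using h2.le

/-- A criterion for quantifier elimination. -/
theorem Theory.exists_isQF_of_embedding (T : L.Theory) (hL : L.card ≤ ℵ₀)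
    (H : ∀ (M N : Type) [L.Structure M] [L.Structure N] [M ⊨ T] [N ⊨ T] [Countable M],
      CountablySaturated L N → ∀ {β : Type} (v : β → M) (w : β → N),
        SameAtomicType L v w → ∃ f : M ↪[L] N, f ∘ v = w)
    {α : Type} [Countable α] {n : ℕ} (φ : L.BoundedFormula α n) :
    ∃ ψ : L.BoundedFormula α n, ψ.IsQF ∧ T.Iff φ ψ := by
  refine φ.induction_on_exists_not (P := fun {m} (φ : L.BoundedFormula α m) =>
    ∃ ψ : L.BoundedFormula α m, ψ.IsQF ∧ T.Iff φ ψ) ?_ ?_ ?_ ?_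
  · exact fun {m} ψ hψ => ⟨ψ, hψ, Theory.Iff.refl ψ⟩
  · rintro m φ ⟨ψ, h1, h2⟩
    refine ⟨ψ.not, h1.not, fun M v xs => ?_⟩
    have := h2 M v xs
    rw [BoundedFormula.realize_iff] at this ⊢
    rw [BoundedFormula.realize_not, BoundedFormula.realize_not, this]
  · rintro m φ ⟨θ, h1, h2⟩
    suffices h : ∃ ψ : L.BoundedFormula α m, ψ.IsQF ∧ T.Iff θ.ex ψ by
      obtain ⟨ψ, h3, h4⟩ := h
      refine ⟨ψ, h3, fun M v xs => ?_⟩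
      have h5 := h4 M v xs
      rw [BoundedFormula.realize_iff] at h5 ⊢
      rw [← h5, BoundedFormula.realize_ex, BoundedFormula.realize_ex]
      refine exists_congr fun a => ?_
      have h6 := h2 M v (Fin.snoc xs a)
      rwa [BoundedFormula.realize_iff] at h6
    refine T.exists_isQF_of_preserved θ.ex fun M N v xs w ys hqf hM => ?_
    -- Agreement on quantifier-free formulas survives shrinking `M` to a countable elementary
    -- substructure around the tuple and enlarging `N` to an ultrapower. The embedding then carries
    -- a witness of the quantifier-free `θ` to a witness.
    obtain ⟨S, hS, hSc⟩ := exists_countable_elementarySubstructure hL M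
      (Set.range (Sum.elim v xs)) (Set.countable_range _)
    let v' : α → S := fun i => ⟨v i, hS ⟨Sum.inl i, rfl⟩⟩
    let xs' : Fin m → S := fun i => ⟨xs i, hS ⟨Sum.inr i, rfl⟩⟩
    have hmap : ∀ ψ : L.BoundedFormula α m, ψ.Realize v' xs' ↔ ψ.Realize v xs := fun ψ =>
      (S.subtype.map_boundedFormula ψ v' xs').symm
    let u := Filter.hyperfilter ℕ
    let N' := (u : Filter ℕ).Product fun _ => (N : Type)
    let diag : N → N' := fun a => ((fun _ => a : ℕ → N) : N')
    have los : ∀ ψ : L.BoundedFormula α m,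
        ψ.Realize (diag ∘ w) (diag ∘ ys) ↔ ψ.Realize w ys := by
      intro ψ
      refine (Ultraproduct.boundedFormula_realize_cast (u := u) ψ (fun i _ => w i)
        (fun i _ => ys i)).trans ?_
      exact Filter.eventually_const
    have hN' : N' ⊨ T := (Theory.model_iff _).2 fun σ hσ => by
      rw [Ultraproduct.sentence_realize]
      exact Filter.Eventually.of_forall fun _ => Theory.realize_sentence_of_mem T hσ
    have hSM : S ⊨ T := (Theory.model_iff _).2 fun σ hσ =>
      (S.realize_sentence σ).2 (Theory.realize_sentence_of_mem T hσ)
    obtain ⟨f, hf⟩ := H S N' (countablySaturated_ultraproduct L _) (Sum.elim v' xs')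
      (Sum.elim (diag ∘ w) (diag ∘ ys))
      (sameAtomicType_of_isQF fun ψ hψ => by rw [hmap, los, hqf ψ hψ])
    rw [← hmap, BoundedFormula.realize_ex] at hM
    obtain ⟨a, ha⟩ := hM
    rw [← los, BoundedFormula.realize_ex]
    refine ⟨f a, ?_⟩
    have e1 : f ∘ v' = diag ∘ w := by
      funext i; exact congrFun hf (Sum.inl i)
    have e2 : f ∘ xs' = diag ∘ ys := by
      funext i; exact congrFun hf (Sum.inr i)
    rw [← e1, ← e2, ← Fin.comp_snoc]
    exact (h1.realize_embedding f).2 ha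
  · intro m φ₁ φ₂ h
    refine exists_congr fun ψ => and_congr_right fun _ => ?_
    have h12 : ∀ (M : ModelType.{0, 0, 0} T) (v : α → M) (xs : Fin m → M),
        φ₁.Realize v xs ↔ φ₂.Realize v xs := fun M v xs => by
      have h0 : M ⊨ (∅ : L.Theory) := by simp
      have := h.realize_bd_iff (M := M) (v := v) (xs := xs)
      exact this
    constructor <;>
    · intro h' M v xs
      have := h' M v xs
      rw [BoundedFormula.realize_iff] at this ⊢
      rw [← this, h12]

end FirstOrder.Language

namespace Pdg

/-! ### Calculus with `χ`: signs, scalars and dominating summands. -/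

section Precontraction

variable {Γ : Type*} [AddCommGroup Γ] [LinearOrder Γ] [IsOrderedAddMonoid Γ] {χ : Γ → Γ}

namespace IsPrecontraction

theorem map_zero (h : IsPrecontraction χ) : χ 0 = 0 := (h.eq_zero_iff 0).2 rfl

theorem monotone (h : IsPrecontraction χ) : Monotone χ := fun a b => h.mono a b

theorem neg_iff (h : IsPrecontraction χ) {a : Γ} : χ a < 0 ↔ a < 0 := by
  constructor
  · intro ha
    by_contra hn
    have := h.mono 0 a (not_lt.1 hn)
    rw [h.map_zero] at this
    exact absurd ha (not_lt.2 this)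
  · intro ha
    refine lt_of_le_of_ne ?_ fun e => ha.ne ((h.eq_zero_iff a).1 e)
    rw [← h.map_zero]
    exact h.mono a 0 ha.le

theorem pos_iff (h : IsPrecontraction χ) {a : Γ} : 0 < χ a ↔ 0 < a := by
  rw [← neg_neg_iff_pos, ← h.map_neg, h.neg_iff, neg_neg_iff_pos]

theorem map_abs (h : IsPrecontraction χ) (a : Γ) : χ |a| = |χ a| := by
  rcases le_total 0 a with ha | ha
  · have := h.mono 0 a ha
    rw [h.map_zero] at this
    rw [abs_of_nonneg ha, abs_of_nonneg this]
  · have := h.mono a 0 ha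
    rw [h.map_zero] at this
    rw [abs_of_nonpos ha, abs_of_nonpos this, h.map_neg]

theorem map_nsmul (h : IsPrecontraction χ) {n : ℕ} (hn : 0 < n) (a : Γ) : χ (n • a) = χ a := by
  refine h.arch _ _ (ArchimedeanClass.mk_eq_mk.2 ⟨⟨1, ?_⟩, ⟨n, ?_⟩⟩) ?_
  · rw [one_nsmul, abs_nsmul]
    exact le_self_nsmul (abs_nonneg a) hn.ne'
  · rw [abs_nsmul]
  · rcases lt_trichotomy a 0 with ha | rfl | ha
    · rw [sign_neg ha, sign_neg (nsmul_neg ha hn.ne')]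
    · simp
    · rw [sign_pos ha, sign_pos (nsmul_pos ha hn.ne')]

theorem lt_of_abs_lt (h : IsPrecontraction χ) {a b : Γ} (hab : |χ a| < |χ b|) : |a| < |b| := by
  rw [← h.map_abs, ← h.map_abs] at hab
  exact h.monotone.reflect_lt hab

/-- As `χ (2a) = χ a`, the hypothesis gives `|2a| < b`. Hence `a + b ≤ 2b` and `b ≤ 2(a + b)`, and
doubling does not change `χ`. -/
theorem add_eq_right_of_pos (h : IsPrecontraction χ) {a b : Γ} (hab : |χ a| < |χ b|) (hb : 0 < b) :
    χ (a + b) = χ b := by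
  have h2 : |χ ((2 : ℕ) • a)| < |χ b| := by rwa [h.map_nsmul two_pos]
  have h3 := h.lt_of_abs_lt h2
  rw [abs_of_pos hb, two_nsmul] at h3
  have h4 := abs_lt.1 h3
  refine le_antisymm ?_ ?_
  · rw [← h.map_nsmul two_pos b]
    have h5 := h.lt_of_abs_lt hab
    rw [abs_of_pos hb] at h5
    refine h.mono _ _ ?_
    rw [two_nsmul]
    exact add_le_add_left (abs_lt.1 h5).2.le b
  · rw [← h.map_nsmul two_pos (a + b)]
    refine h.mono _ _ ?_
    rw [two_nsmul, add_add_add_comm, ← add_assoc]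
    exact le_add_of_nonneg_left (neg_le_iff_add_nonneg.1 h4.1.le)

/-- The map `χ` is determined by the dominating summand. -/
theorem add_eq_right (h : IsPrecontraction χ) {a b : Γ} (hab : |χ a| < |χ b|) :
    χ (a + b) = χ b := by
  rcases lt_trichotomy b 0 with hb | rfl | hb
  · have := h.add_eq_right_of_pos (a := -a) (b := -b) (by simpa [h.map_neg] using hab)
      (neg_pos.2 hb)
    rwa [← neg_add, h.map_neg, h.map_neg, neg_inj] at this
  · rw [h.map_zero, abs_zero] at hab
    exact absurd hab (not_lt.2 (abs_nonneg _))
  · exact h.add_eq_right_of_pos hab hb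

theorem add_eq_left (h : IsPrecontraction χ) {a b : Γ} (hab : |χ b| < |χ a|) :
    χ (a + b) = χ a := by
  rw [add_comm, h.add_eq_right hab]

theorem sub_eq_left (h : IsPrecontraction χ) {a b : Γ} (hab : |χ b| < |χ a|) :
    χ (a - b) = χ a := by
  rw [sub_eq_add_neg, h.add_eq_left]
  rwa [h.map_neg, abs_neg]

theorem sub_eq_right (h : IsPrecontraction χ) {a b : Γ} (hab : |χ a| < |χ b|) :
    χ (a - b) = -χ b := by
  rw [← neg_sub, h.map_neg, h.sub_eq_left hab]

variable [Module ℚ Γ]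

theorem map_qsmul (h : IsPrecontraction χ) {q : ℚ} (hq : 0 < q) (a : Γ) : χ (q • a) = χ a := by
  rw [← h.map_nsmul q.den_pos (q • a), ← h.map_nsmul (n := q.num.toNat) (by
    have := Rat.num_pos.2 hq
    omega) a]
  congr 1
  rw [← Nat.cast_smul_eq_nsmul ℚ, ← Nat.cast_smul_eq_nsmul ℚ, smul_smul, Rat.den_mul_eq_num]
  congr 1
  have := Rat.num_pos.2 hq
  have h2 : ((q.num.toNat : ℤ) : ℚ) = q.num := by rw [Int.toNat_of_nonneg this.le]
  rw [← h2, Int.cast_natCast]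

theorem map_qsmul_of_neg (h : IsPrecontraction χ) {q : ℚ} (hq : q < 0) (a : Γ) :
    χ (q • a) = -χ a := by
  rw [← neg_neg q, neg_smul, h.map_neg, h.map_qsmul (neg_pos.2 hq)]

end IsPrecontraction

end Precontraction

/-! ### The set `χ(Γ^{<0})` as a discrete order with successor map `χ`. -/

section NegImage

variable {Γ : Type*} [AddCommGroup Γ] [LinearOrder Γ] [IsOrderedAddMonoid Γ] {χ : Γ → Γ} {c : Γ}

namespace IsModel

theorem neg_of_mem (h : IsModel χ c) {d : Γ} (hd : d ∈ negImage χ) : d < 0 := by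
  obtain ⟨a, ha, rfl⟩ := hd
  exact h.neg_iff.2 ha

theorem map_mem (h : IsModel χ c) {d : Γ} (hd : d ∈ negImage χ) : χ d ∈ negImage χ :=
  ⟨d, h.neg_of_mem hd, rfl⟩

theorem iterate_mem (h : IsModel χ c) {d : Γ} (hd : d ∈ negImage χ) (n : ℕ) :
    χ^[n] d ∈ negImage χ := by
  induction n with
  | zero => exact hd
  | succ n ih => rw [Function.iterate_succ_apply']; exact h.map_mem ih

theorem lt_map (h : IsModel χ c) {d : Γ} (hd : d < 0) : d < χ d := by
  have := h.centripetal d hd.ne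
  rw [abs_of_neg hd, abs_of_neg (h.neg_iff.2 hd)] at this
  exact neg_lt_neg_iff.1 this

theorem le_iterate (h : IsModel χ c) {d : Γ} (hd : d ∈ negImage χ) (n : ℕ) : d ≤ χ^[n] d := by
  induction n with
  | zero => exact le_rfl
  | succ n ih =>
    rw [Function.iterate_succ_apply']
    exact ih.trans (h.lt_map (h.neg_of_mem (h.iterate_mem hd n))).le

theorem strictMonoOn (h : IsModel χ c) : StrictMonoOn χ (negImage χ) := fun a ha b hb hab =>
  lt_of_le_of_ne (h.mono a b hab.le) fun e => hab.ne (h.bijOn.injOn ha hb e)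

theorem iterate_le_iff (h : IsModel χ c) {a b : Γ} (ha : a ∈ negImage χ) (hb : b ∈ negImage χ)
    (n : ℕ) : χ^[n] a ≤ χ^[n] b ↔ a ≤ b := by
  induction n with
  | zero => exact Iff.rfl
  | succ n ih =>
    rw [Function.iterate_succ_apply', Function.iterate_succ_apply',
      h.strictMonoOn.le_iff_le (h.iterate_mem ha n) (h.iterate_mem hb n), ih]

theorem iterate_le_iterate_iff (h : IsModel χ c) {b : Γ} (hb : b ∈ negImage χ) {m n : ℕ} :
    χ^[m] b ≤ χ^[n] b ↔ m ≤ n := by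
  have hmono : StrictMono fun n => χ^[n] b := strictMono_nat_of_lt_succ fun n => by
    rw [Function.iterate_succ_apply']
    exact h.lt_map (h.neg_of_mem (h.iterate_mem hb n))
  exact hmono.le_iff_le

/-- Discreteness turns strict inequalities into weak ones between iterates of `χ`, so partial maps
on the image need only preserve the latter. -/
theorem lt_iff_map_le (h : IsModel χ c) {a b : Γ} (ha : a ∈ negImage χ) (hb : b ∈ negImage χ) :
    a < b ↔ χ a ≤ b :=
  ⟨fun hab => (h.succ a ha b hb hab).2, fun hab => (h.lt_map (h.neg_of_mem ha)).trans_le hab⟩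

/-- Every element of the image other than `c` has a predecessor, so from any element at or above
`χ^[n] c` one can descend `n` steps. -/
theorem exists_iterate_eq (h : IsModel χ c) (n : ℕ) {d : Γ} (hd : d ∈ negImage χ)
    (hcd : χ^[n] c ≤ d) : ∃ e ∈ negImage χ, χ^[n] e = d := by
  induction n generalizing d with
  | zero => exact ⟨d, hd, rfl⟩
  | succ n ih =>
    have hc := h.isLeast.1
    have h1 : c < d := by
      refine lt_of_lt_of_le ((h.le_iterate hc n).trans_lt ?_) hcd
      rw [Function.iterate_succ_apply']
      exact h.lt_map (h.neg_of_mem (h.iterate_mem hc n))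
    obtain ⟨p, hp, rfl⟩ := h.bijOn.surjOn ⟨hd, h1⟩
    rw [Function.iterate_succ_apply', h.strictMonoOn.le_iff_le (h.iterate_mem hc n) hp] at hcd
    obtain ⟨e, he, rfl⟩ := ih hp hcd
    exact ⟨e, he, Function.iterate_succ_apply' _ _ _⟩

end IsModel

end NegImage

/-! ### Saturation for cuts -/

section Cuts

variable {Γ : Type*} [AddCommGroup Γ] [LinearOrder Γ] [IsOrderedAddMonoid Γ]

/-- The upward closed sets `{x | p ≤ χⁿ(x - a)}`. -/
def IsUpperCut (χ : Γ → Γ) (S : Set Γ) : Prop :=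
  ∃ (n : ℕ) (a p : Γ), S = {x | p ≤ χ^[n] (x - a)}

/-- The downward closed sets `{x | χⁿ(x - a) ≤ p}`, and the set of negative elements. -/
def IsLowerCut (χ : Γ → Γ) (S : Set Γ) : Prop :=
  (∃ (n : ℕ) (a p : Γ), S = {x | χ^[n] (x - a) ≤ p}) ∨ S = Set.Iio 0

/-- Countably many pairwise compatible upper and lower cuts have a common element. -/
def CutSaturated (χ : Γ → Γ) : Prop :=
  ∀ 𝒰 𝒱 : Set (Set Γ), 𝒰.Countable → 𝒱.Countable → 𝒰.Nonempty → 𝒱.Nonempty →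
    (∀ U ∈ 𝒰, IsUpperCut χ U) → (∀ V ∈ 𝒱, IsLowerCut χ V) →
    (∀ U ∈ 𝒰, ∀ V ∈ 𝒱, (U ∩ V).Nonempty) → ∃ x, (∀ U ∈ 𝒰, x ∈ U) ∧ ∀ V ∈ 𝒱, x ∈ V

end Cuts

/-! ### Extending maps between the images `χ(Γ^{<0})` -/

section ImageMaps

variable {Γ Γ' : Type*} [AddCommGroup Γ] [LinearOrder Γ] [AddCommGroup Γ'] [LinearOrder Γ']
  {χ : Γ → Γ} {c : Γ} {χ' : Γ' → Γ'} {c' : Γ'}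

/-- `E` is a partial isomorphism between `χ(Γ^{<0})` and `χ'(Γ'^{<0})`, as ordered sets with a
successor map. -/
structure IsImageIso (χ : Γ → Γ) (c : Γ) (χ' : Γ' → Γ') (c' : Γ') (E : Set (Γ × Γ')) : Prop where
  mem_left : ∀ p ∈ E, p.1 ∈ negImage χ
  mem_right : ∀ p ∈ E, p.2 ∈ negImage χ'
  least : (c, c') ∈ E
  le : ∀ p ∈ E, ∀ q ∈ E, ∀ m n : ℕ, χ^[m] p.1 ≤ χ^[n] q.1 → χ'^[m] p.2 ≤ χ'^[n] q.2

theorem IsImageIso.right_unique {E : Set (Γ × Γ')} (hE : IsImageIso χ c χ' c' E) {p q : Γ × Γ'}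
    (hp : p ∈ E) (hq : q ∈ E) (h : p.1 = q.1) : p.2 = q.2 :=
  le_antisymm (hE.le p hp q hq 0 0 h.le) (hE.le q hq p hp 0 0 h.ge)

variable [IsOrderedAddMonoid Γ] [IsOrderedAddMonoid Γ']

/-- The image of `b` has to satisfy countably many lower and upper bounds on its iterates. By
saturation it is enough to meet one lower and one upper bound at a time. -/
theorem IsImageIso.exists_insert (h : IsModel χ c) (h' : IsModel χ' c') (hs : CutSaturated χ')
    [Countable Γ] {E : Set (Γ × Γ')} (hE : IsImageIso χ c χ' c' E) {b : Γ} (hb : b ∈ negImage χ) :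
    ∃ b' : Γ', IsImageIso χ c χ' c' (insert (b, b') E) := by
  have hEc : E.Countable := by
    refine Set.MapsTo.countable_of_injOn (f := Prod.fst) (t := Set.univ) (fun _ _ => trivial) ?_
      Set.countable_univ
    exact fun p hp q hq e => Prod.ext e (hE.right_unique hp hq e)
  -- The unknown is an element `y` with `b' = χ' y`, whence the exponent `n + 1`; the cut `Set.Iio
  -- 0` in `𝒱` puts `χ' y` into the image.
  let 𝒰 : Set (Set Γ') := (fun i : (Γ × Γ') × ℕ × ℕ =>
    {y | χ'^[i.2.1] i.1.2 ≤ χ'^[i.2.2 + 1] (y - 0)}) ''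
      {i | i.1 ∈ E ∧ χ^[i.2.1] i.1.1 ≤ χ^[i.2.2] b}
  let 𝒱 : Set (Set Γ') := insert (Set.Iio 0) ((fun i : (Γ × Γ') × ℕ × ℕ =>
    {y | χ'^[i.2.2 + 1] (y - 0) ≤ χ'^[i.2.1] i.1.2}) ''
      {i | i.1 ∈ E ∧ χ^[i.2.2] b ≤ χ^[i.2.1] i.1.1})
  have hcount : ∀ P : (Γ × Γ') × ℕ × ℕ → Prop, {i | i.1 ∈ E ∧ P i}.Countable := fun P =>
    (hEc.prod (Set.countable_univ (α := ℕ × ℕ))).mono fun i hi =>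
      Set.mk_mem_prod hi.1 (Set.mem_univ _)
  have h𝒰 : 𝒰.Countable := (hcount fun i => χ^[i.2.1] i.1.1 ≤ χ^[i.2.2] b).image _
  have h𝒱 : 𝒱.Countable := ((hcount fun i => χ^[i.2.2] b ≤ χ^[i.2.1] i.1.1).image _).insert _
  obtain ⟨y, hyU, hyV⟩ := hs 𝒰 𝒱 h𝒰 h𝒱
    (Set.Nonempty.image _ ⟨((c, c'), 0, 0), hE.least, h.isLeast.2 hb⟩) ⟨_, Set.mem_insert _ _⟩
    (by
      rintro _ ⟨i, -, rfl⟩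
      exact ⟨_, _, _, rfl⟩)
    (by
      rintro _ (rfl | ⟨i, -, rfl⟩)
      · exact Or.inr rfl
      · exact Or.inl ⟨_, _, _, rfl⟩)
    (by
      rintro _ ⟨⟨p, m₁, n₁⟩, ⟨hp, hp1⟩, rfl⟩ V hV
      dsimp only at hp hp1
      have hpm := h'.iterate_mem (hE.mem_right p hp) m₁
      rcases hV with rfl | ⟨⟨q, m₂, n₂⟩, ⟨hq, hq1⟩, rfl⟩
      · obtain ⟨y, hy, hye⟩ := id hpm
        refine ⟨y, ?_, hy⟩
        simp only [sub_zero, Set.mem_ofPred_eq, Function.iterate_succ_apply, hye]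
        exact h'.le_iterate hpm n₁
      · dsimp only at hq hq1
        suffices hsuff : ∃ d ∈ negImage χ', χ'^[m₁] p.2 ≤ χ'^[n₁] d ∧
            χ'^[n₂] d ≤ χ'^[m₂] q.2 by
          obtain ⟨_, ⟨y, hy, rfl⟩, h1, h2⟩ := hsuff
          refine ⟨y, ?_, ?_⟩
          · simpa only [sub_zero, Set.mem_ofPred_eq, Function.iterate_succ_apply] using h1
          · simpa only [sub_zero, Set.mem_ofPred_eq, Function.iterate_succ_apply] using h2
        have hpl := h.iterate_mem (hE.mem_left p hp) m₁
        -- The candidate is the least element satisfying the lower bound: `c'`, or else the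
        -- `n₁`-fold predecessor of `χ'^[m₁] p.2`.
        rcases le_total (χ^[m₁] p.1) (χ^[n₁] c) with hl | hl
        · refine ⟨c', h'.isLeast.1, hE.le p hp _ hE.least _ _ hl, ?_⟩
          refine hE.le _ hE.least q hq _ _ (le_trans ?_ hq1)
          exact (h.iterate_le_iff h.isLeast.1 hb _).2 (h.isLeast.2 hb)
        · obtain ⟨e, he, hee⟩ := h'.exists_iterate_eq n₁ hpm (hE.le _ hE.least p hp _ _ hl)
          refine ⟨e, he, hee.ge, ?_⟩
          -- Applying `χ'^[n₁]` removes the predecessor and leaves an inequality between iterates of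
          -- `p.2` and `q.2`, which `E` transports from `Γ`.
          rw [← h'.iterate_le_iff (h'.iterate_mem he _)
            (h'.iterate_mem (hE.mem_right q hq) _) n₁, ← Function.iterate_add_apply, add_comm,
            Function.iterate_add_apply, hee, ← Function.iterate_add_apply,
            ← Function.iterate_add_apply]
          refine hE.le p hp q hq _ _ ?_
          rw [Function.iterate_add_apply, Function.iterate_add_apply]
          calc χ^[n₂] (χ^[m₁] p.1) ≤ χ^[n₂] (χ^[n₁] b) :=
                (h.monotone.iterate n₂) hp1
            _ = χ^[n₁] (χ^[n₂] b) := by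
                rw [← Function.iterate_add_apply, add_comm, Function.iterate_add_apply]
            _ ≤ χ^[n₁] (χ^[m₂] q.1) := (h.monotone.iterate n₁) hq1)
  have hy0 : y < 0 := hyV _ (Set.mem_insert _ _)
  have hU : ∀ p ∈ E, ∀ m n : ℕ, χ^[m] p.1 ≤ χ^[n] b → χ'^[m] p.2 ≤ χ'^[n] (χ' y) := by
    intro p hp m n hl
    have : y ∈ {y | χ'^[m] p.2 ≤ χ'^[n + 1] (y - 0)} := hyU _ ⟨(p, m, n), ⟨hp, hl⟩, rfl⟩
    simpa only [sub_zero, Set.mem_ofPred_eq, Function.iterate_succ_apply] using this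
  have hV : ∀ p ∈ E, ∀ m n : ℕ, χ^[n] b ≤ χ^[m] p.1 → χ'^[n] (χ' y) ≤ χ'^[m] p.2 := by
    intro p hp m n hl
    have : y ∈ {y | χ'^[n + 1] (y - 0) ≤ χ'^[m] p.2} :=
      hyV _ (Set.mem_insert_of_mem _ ⟨(p, m, n), ⟨hp, hl⟩, rfl⟩)
    simpa only [sub_zero, Set.mem_ofPred_eq, Function.iterate_succ_apply] using this
  refine ⟨χ' y, ⟨?_, ?_, Set.mem_insert_of_mem _ hE.least, ?_⟩⟩
  · rintro p (rfl | hp)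
    · exact hb
    · exact hE.mem_left p hp
  · rintro p (rfl | hp)
    · exact ⟨y, hy0, rfl⟩
    · exact hE.mem_right p hp
  · rintro p (rfl | hp) q (rfl | hq) m n hl
    · rw [h.iterate_le_iterate_iff hb] at hl
      obtain ⟨k, rfl⟩ := Nat.exists_eq_add_of_le hl
      dsimp only
      rw [add_comm, Function.iterate_add_apply, ← Function.iterate_add_apply, add_comm,
        Function.iterate_add_apply]
      exact h'.monotone.iterate m (h'.le_iterate ⟨y, hy0, rfl⟩ k)
    · exact hV q hq _ _ hl
    · exact hU p hp _ _ hl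
    · exact hE.le p hp q hq m n hl

/-- A maximal partial isomorphism is defined on the whole image. Comparing a zeroth with a first
iterate then yields both strict monotonicity and commutation with `χ`. -/
theorem IsImageIso.exists_total (h : IsModel χ c) (h' : IsModel χ' c') (hs : CutSaturated χ')
    [Countable Γ] {E₀ : Set (Γ × Γ')} (hE₀ : IsImageIso χ c χ' c' E₀) :
    ∃ e : Γ → Γ', (∀ p ∈ E₀, e p.1 = p.2) ∧ (∀ d ∈ negImage χ, e d ∈ negImage χ') ∧
      StrictMonoOn e (negImage χ) ∧ ∀ d ∈ negImage χ, e (χ d) = χ' (e d) := by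
  obtain ⟨E, hE₀E, hmax⟩ := zorn_subset_nonempty {E | IsImageIso χ c χ' c' E} (by
    intro C hC hchain hne
    refine ⟨⋃₀ C, ⟨?_, ?_, ?_, ?_⟩, fun s hs => Set.subset_sUnion_of_mem hs⟩
    · rintro p ⟨s, hs, hp⟩
      exact (hC hs).mem_left p hp
    · rintro p ⟨s, hs, hp⟩
      exact (hC hs).mem_right p hp
    · obtain ⟨s, hs⟩ := hne
      exact ⟨s, hs, (hC hs).least⟩
    · rintro p ⟨s, hs, hp⟩ q ⟨t, ht, hq⟩
      rcases hchain.total hs ht with hst | hst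
      · exact (hC ht).le p (hst hp) q hq
      · exact (hC hs).le p hp q (hst hq)) E₀ hE₀
  have hE : IsImageIso χ c χ' c' E := hmax.prop
  have htot : ∀ d, ∃ d', d ∈ negImage χ → (d, d') ∈ E := by
    intro d
    by_cases hd : d ∈ negImage χ
    · obtain ⟨d', hd'⟩ := hE.exists_insert h h' hs hd
      exact ⟨d', fun _ => hmax.le_of_ge hd' (Set.subset_insert _ _) (Set.mem_insert _ _)⟩
    · exact ⟨0, fun hd' => absurd hd' hd⟩
  choose e he using htot
  refine ⟨e, fun p hp => hE.right_unique (he p.1 (hE₀.mem_left p hp)) (hE₀E hp) rfl,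
    fun d hd => hE.mem_right _ (he d hd), fun a ha b hb hab => ?_, fun d hd => ?_⟩
  · rw [h'.lt_iff_map_le (hE.mem_right _ (he a ha)) (hE.mem_right _ (he b hb))]
    exact hE.le _ (he a ha) _ (he b hb) 1 0 ((h.lt_iff_map_le ha hb).1 hab)
  · exact le_antisymm (hE.le _ (he _ (h.map_mem hd)) _ (he d hd) 0 1 le_rfl)
      (hE.le _ (he d hd) _ (he _ (h.map_mem hd)) 1 0 le_rfl)

end ImageMaps

end Pdg

namespace Pdg

/-! ### Order embeddings of the values of `χ`. -/

section ValueMaps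

variable {Γ Γ' : Type*} [AddCommGroup Γ] [LinearOrder Γ] [AddCommGroup Γ'] [LinearOrder Γ']

/-- `e` embeds the image of `χ` into the image of `χ'`, as ordered sets with a negation, and
commutes with `χ` and `χ'` on `χ(Γ^{<0})`. -/
structure IsValueMap (χ : Γ → Γ) (χ' : Γ' → Γ') (e : Γ → Γ') : Prop where
  exists_eq : ∀ x, ∃ y, χ' y = e (χ x)
  strictMono : ∀ x y, χ x < χ y → e (χ x) < e (χ y)
  map_neg : ∀ x, e (-χ x) = -e (χ x)
  mem : ∀ d ∈ negImage χ, e d ∈ negImage χ'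
  map_map : ∀ d ∈ negImage χ, χ' (e d) = e (χ d)

theorem IsValueMap.lt_iff {χ : Γ → Γ} {χ' : Γ' → Γ'} {e : Γ → Γ'} (he : IsValueMap χ χ' e)
    (x y : Γ) : e (χ x) < e (χ y) ↔ χ x < χ y := by
  refine ⟨fun hlt => ?_, he.strictMono x y⟩
  by_contra hn
  rcases (not_lt.1 hn).lt_or_eq with h1 | h1
  · exact lt_asymm hlt (he.strictMono _ _ h1)
  · rw [h1] at hlt
    exact lt_irrefl _ hlt

/-- The partial map with graph `G` is compatible with the map `e` of values. -/
def IsCompatible [Module ℚ Γ] [Module ℚ Γ'] (χ : Γ → Γ) (χ' : Γ' → Γ') (e : Γ → Γ')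
    (G : Submodule ℚ (Γ × Γ')) : Prop :=
  ∀ p ∈ G, χ' p.2 = e (χ p.1)

variable [IsOrderedAddMonoid Γ] [IsOrderedAddMonoid Γ']
  {χ : Γ → Γ} {c : Γ} {χ' : Γ' → Γ'} {c' : Γ'} {e : Γ → Γ'}

open Classical in
-- The map is extended oddly through `0`. Comparisons of nonpositive values come from `e`, those of
-- nonnegative values by negation, and mixed ones by passing through `0`.
theorem exists_isValueMap (h : IsModel χ c) (h' : IsModel χ' c') {e : Γ → Γ'}
    (hmem : ∀ d ∈ negImage χ, e d ∈ negImage χ') (hmono : StrictMonoOn e (negImage χ))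
    (hmap : ∀ d ∈ negImage χ, e (χ d) = χ' (e d)) :
    ∃ f : Γ → Γ', IsValueMap χ χ' f ∧ ∀ d ∈ negImage χ, f d = e d := by
  let f : Γ → Γ' := fun x => if x < 0 then e x else if x = 0 then 0 else -e (-x)
  have f0 : f 0 = 0 := by simp [f]
  have fneg : ∀ x < 0, f x = e x := fun x hx => by simp [f, hx]
  have fpos : ∀ x > 0, f x = -e (-x) := fun x hx => by
    simp [f, not_lt.2 (le_of_lt hx), ne_of_gt hx]
  have hD : ∀ d ∈ negImage χ, f d = e d := fun d hd => fneg d (h.neg_of_mem hd)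
  have hmemχ : ∀ x < 0, χ x ∈ negImage χ := fun x hx => ⟨x, hx, rfl⟩
  have heneg : ∀ x < 0, e (χ x) < 0 := fun x hx => h'.neg_of_mem (hmem _ (hmemχ x hx))
  have hodd : ∀ x, f (-χ x) = -f (χ x) := by
    intro x
    rcases lt_trichotomy (χ x) 0 with hx | hx | hx
    · rw [fneg _ hx, fpos _ (neg_pos.2 hx), neg_neg]
    · rw [hx, neg_zero, f0, neg_zero]
    · rw [fpos _ hx, fneg _ (neg_neg_of_pos hx), neg_neg]
  have hlt : ∀ x y, y ≤ 0 → χ x < χ y → f (χ x) < f (χ y) := by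
    intro x y hy hxy
    have hx0 : x < 0 := (h.monotone.reflect_lt hxy).trans_le hy
    rw [fneg _ (h.neg_iff.2 hx0)]
    rcases hy.lt_or_eq with hy | rfl
    · rw [fneg _ (h.neg_iff.2 hy)]
      exact hmono (hmemχ x hx0) (hmemχ y hy) hxy
    · rw [h.map_zero, f0]
      exact heneg x hx0
  refine ⟨f, ⟨fun x => ?_, fun x y hxy => ?_, hodd, fun d hd => ?_, fun d hd => ?_⟩, hD⟩
  · rcases lt_trichotomy x 0 with hx | rfl | hx
    · obtain ⟨y, -, hy⟩ := hmem _ (hmemχ x hx)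
      exact ⟨y, by rw [hy, fneg _ (h.neg_iff.2 hx)]⟩
    · exact ⟨0, by rw [h.map_zero, h'.map_zero, f0]⟩
    · obtain ⟨y, -, hy⟩ := hmem _ (hmemχ (-x) (neg_neg_of_pos hx))
      exact ⟨-y, by rw [h'.map_neg, hy, fpos _ (h.pos_iff.2 hx), h.map_neg]⟩
  · rcases le_total y 0 with hy | hy
    · exact hlt x y hy hxy
    · rcases le_total 0 x with hx | hx
      · have := hlt (-y) (-x) (neg_nonpos.2 hx) (by rwa [h.map_neg, h.map_neg, neg_lt_neg_iff])
        rw [h.map_neg, h.map_neg, hodd, hodd] at this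
        exact neg_lt_neg_iff.1 this
      · rcases hx.lt_or_eq with hx | rfl
        · have h1 := hlt x 0 le_rfl (by rw [h.map_zero]; exact h.neg_iff.2 hx)
          rcases hy.lt_or_eq with hy | rfl
          · have h2 := hlt (-y) 0 le_rfl (by
              rw [h.map_zero]; exact h.neg_iff.2 (neg_neg_of_pos hy))
            rw [h.map_zero, f0] at h1 h2
            rw [h.map_neg, hodd] at h2
            exact h1.trans (neg_neg_iff_pos.1 h2)
          · exact h1
        · have h2 := hlt (-y) 0 le_rfl (by
            rw [h.map_neg]
            rw [h.map_zero] at hxy ⊢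
            exact neg_neg_of_pos hxy)
          rw [h.map_zero, f0, h.map_neg, hodd] at h2
          rw [h.map_zero, f0]
          exact neg_neg_iff_pos.1 h2
  · rw [hD d hd]
    exact hmem d hd
  · rw [hD d hd, hD _ (h.map_mem hd), hmap d hd]

namespace IsValueMap

variable (he : IsValueMap χ χ' e)
include he

theorem map_zero (h : IsPrecontraction χ) : e 0 = 0 := by
  have := he.map_neg 0
  rw [h.map_zero, neg_zero] at this
  exact self_eq_neg.1 this

theorem abs_map (h : IsPrecontraction χ) (x : Γ) : |e (χ x)| = e (χ |x|) := by
  rcases le_total 0 x with hx | hx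
  · rw [abs_of_nonneg hx, abs_of_nonneg]
    rw [← he.map_zero h, ← h.map_zero]
    exact not_lt.1 fun hlt => absurd ((he.lt_iff _ _).1 hlt) (not_lt.2 (h.mono _ _ hx))
  · rw [abs_of_nonpos hx, h.map_neg, he.map_neg, abs_of_nonpos]
    rw [← he.map_zero h, ← h.map_zero]
    exact not_lt.1 fun hlt => absurd ((he.lt_iff _ _).1 hlt) (not_lt.2 (h.mono _ _ hx))

/-- Which summand dominates, and hence the value of a sum, can be read off after applying `e`. -/
theorem abs_lt_iff (h : IsPrecontraction χ) (x y : Γ) :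
    |e (χ x)| < |e (χ y)| ↔ |χ x| < |χ y| := by
  rw [he.abs_map h, he.abs_map h, he.lt_iff, h.map_abs, h.map_abs]

/-- Any two conditions on an element of an extension can be satisfied simultaneously. -/
theorem exists_pair [Module ℚ Γ'] (h : IsPrecontraction χ) (h' : IsPrecontraction χ')
    {x : Γ} {g : Γ'} (hg : χ' g = e (χ x)) (r : Γ) :
    ∃ s, χ' s = e (χ r) ∧ χ' (s - g) = e (χ (r - x)) := by
  obtain ⟨w₁, hw₁⟩ := he.exists_eq r
  obtain ⟨w₂, hw₂⟩ := he.exists_eq (r - x)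
  -- If one of `r` and `x` dominates, it determines the value of `r - x`, so any `s` with the value
  -- prescribed by `r` will do.
  rcases lt_trichotomy |χ r| |χ x| with hlt | heq | hgt
  · refine ⟨w₁, hw₁, ?_⟩
    rw [h.sub_eq_right hlt, h'.sub_eq_right, hg, he.map_neg]
    rwa [hw₁, hg, he.abs_lt_iff h]
  · by_cases h2 : |χ (r - x)| < |χ x|
    · refine ⟨g + w₂, ?_, by rw [add_sub_cancel_left, hw₂]⟩
      have h3 : χ r = χ x := by
        conv_lhs => rw [← add_sub_cancel x r]
        exact h.add_eq_left h2
      rw [h3, ← hg, h'.add_eq_left]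
      rwa [hw₂, hg, he.abs_lt_iff h]
    · have h3 : |χ (r - x)| = |χ x| := by
        refine le_antisymm (not_lt.1 fun hgt => ?_) (not_lt.1 h2)
        have h4 : χ r = χ (r - x) := by
          conv_lhs => rw [← sub_add_cancel r x]
          exact h.add_eq_left hgt
        rw [← h4, heq] at hgt
        exact lt_irrefl _ hgt
      -- All values now agree up to sign, and a multiple of `g` suffices: `2g`, `g/2`, `g`, `-g` for
      -- the four sign patterns. The third pattern is consistent only for `x = 0`.
      rcases abs_eq_abs.1 heq with h4 | h4 <;> rcases abs_eq_abs.1 h3 with h5 | h5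
      · refine ⟨(2 : ℕ) • g, ?_, ?_⟩
        · rw [h'.map_nsmul two_pos, h4, hg]
        · rw [two_nsmul, add_sub_cancel_right, h5, hg]
      · refine ⟨(1 / 2 : ℚ) • g, ?_, ?_⟩
        · rw [h'.map_qsmul (by norm_num), h4, hg]
        · have : (1 / 2 : ℚ) • g - g = (-1 / 2 : ℚ) • g := by
            conv_lhs => rw [← one_smul ℚ g, smul_smul, ← sub_smul]
            norm_num
          rw [this, h'.map_qsmul_of_neg (by norm_num), h5, he.map_neg, hg]
      · have h6 : x = 0 := by
          rcases lt_trichotomy x 0 with hx | hx | hx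
          · have h7 : r - x < 0 := h.neg_iff.1 (h5 ▸ h.neg_iff.2 hx)
            have h8 : 0 < r := h.pos_iff.1 (h4 ▸ neg_pos.2 (h.neg_iff.2 hx))
            exact absurd (sub_neg.1 h7) (not_lt.2 (hx.trans h8).le)
          · exact hx
          · have h7 : 0 < r - x := h.pos_iff.1 (h5 ▸ h.pos_iff.2 hx)
            have h8 : r < 0 := h.neg_iff.1 (h4 ▸ neg_neg_of_pos (h.pos_iff.2 hx))
            exact absurd (sub_pos.1 h7) (not_lt.2 (h8.trans hx).le)
        subst h6
        refine ⟨g, ?_, ?_⟩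
        · rw [h4, hg, h.map_zero, neg_zero]
        · rw [h5, sub_self, h.map_zero, h'.map_zero, he.map_zero h]
      · refine ⟨-g, ?_, ?_⟩
        · rw [h'.map_neg, h4, he.map_neg, hg]
        · have : -g - g = -((2 : ℕ) • g) := by rw [two_nsmul]; abel
          rw [this, h'.map_neg, h'.map_nsmul two_pos, h5, he.map_neg, hg]
  · refine ⟨w₁, hw₁, ?_⟩
    rw [h.sub_eq_left hgt, h'.sub_eq_left, hw₁]
    rwa [hw₁, hg, he.abs_lt_iff h]

end IsValueMap

/-! ### Extending `ℚ`-linear partial maps that are compatible with a map of values. -/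

section Graphs

variable [Module ℚ Γ] [Module ℚ Γ'] {G : Submodule ℚ (Γ × Γ')}

/-- As `χ` sees only the sign of a nonzero scalar, this reduces statements about the values on the
enlarged domain to the translates `v - p`. -/
theorem exists_smul_sub_of_mem_sup_span {V : Type*} [AddCommGroup V] [Module ℚ V]
    {G : Submodule ℚ V} {v z : V} (hz : z ∈ G ⊔ Submodule.span ℚ {v}) :
    z ∈ G ∨ ∃ p ∈ G, ∃ q : ℚ, q ≠ 0 ∧ z = q • (v - p) := by
  obtain ⟨p, hp, w, hw, rfl⟩ := Submodule.mem_sup.1 hz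
  obtain ⟨q, rfl⟩ := Submodule.mem_span_singleton.1 hw
  by_cases hq : q = 0
  · subst hq
    left
    simpa using hp
  · refine Or.inr ⟨-(q⁻¹ • p), G.neg_mem (G.smul_mem _ hp), q, hq, ?_⟩
    rw [sub_neg_eq_add, smul_add, smul_smul, mul_inv_cancel₀ hq, one_smul, add_comm]

/-- `χ'` vanishes only at `0`; this is what makes a compatible `G` the graph of a function. -/
theorem IsCompatible.fst_eq_zero (h : IsPrecontraction χ) (h' : IsPrecontraction χ')
    (he : IsValueMap χ χ' e) (hG : IsCompatible χ χ' e G) {p : Γ × Γ'} (hp : p ∈ G)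
    (h0 : p.1 = 0) : p.2 = 0 := by
  rw [← h'.eq_zero_iff, hG p hp, h0, h.map_zero, he.map_zero h]

theorem IsCompatible.snd_unique (h : IsPrecontraction χ) (h' : IsPrecontraction χ')
    (he : IsValueMap χ χ' e) (hG : IsCompatible χ χ' e G) {p q : Γ × Γ'} (hp : p ∈ G) (hq : q ∈ G)
    (h0 : p.1 = q.1) : p.2 = q.2 :=
  sub_eq_zero.1 (hG.fst_eq_zero h h' he (G.sub_mem hp hq) (sub_eq_zero.2 h0))

/-- An element has the sign of its value, and `e` preserves signs of values. Applied to differences,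
this makes compatible maps preserve the order. -/
theorem IsCompatible.snd_neg_iff (h : IsPrecontraction χ) (h' : IsPrecontraction χ')
    (he : IsValueMap χ χ' e) (hG : IsCompatible χ χ' e G) {p : Γ × Γ'} (hp : p ∈ G) :
    p.2 < 0 ↔ p.1 < 0 := by
  rw [← h'.neg_iff, hG p hp, ← he.map_zero h, ← h.map_zero, he.lt_iff, h.map_zero, h.neg_iff]

theorem IsCompatible.sup_span (h : IsPrecontraction χ) (h' : IsPrecontraction χ')
    (he : IsValueMap χ χ' e) (hG : IsCompatible χ χ' e G) {b : Γ} {b' : Γ'}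
    (hb : ∀ p ∈ G, χ' (b' - p.2) = e (χ (b - p.1))) :
    IsCompatible χ χ' e (G ⊔ Submodule.span ℚ {(b, b')}) := by
  intro z hz
  rcases exists_smul_sub_of_mem_sup_span hz with hz | ⟨p, hp, q, hq, rfl⟩
  · exact hG z hz
  · simp only [Prod.smul_fst, Prod.smul_snd, Prod.fst_sub, Prod.snd_sub]
    rcases lt_or_gt_of_ne hq with hq | hq
    · rw [h.map_qsmul_of_neg hq, h'.map_qsmul_of_neg hq, he.map_neg, hb p hp]
    · rw [h.map_qsmul hq, h'.map_qsmul hq, hb p hp]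

/-- The domain of the partial map `G` contains the element `d` of `χ(Γ^{<0})` as soon as it contains
an element with the value `χ d`. -/
def IsImageClosed (χ : Γ → Γ) (e : Γ → Γ') (G : Submodule ℚ (Γ × Γ')) : Prop :=
  ∀ p ∈ G, ∀ d ∈ negImage χ, χ p.1 = χ d → (d, e d) ∈ G

/-- If `(d, e d)` is not yet in `G`, image-closedness says that `χ d` differs, even up to sign, from
all values on the domain. So in `d - p` one of the terms dominates, on both sides alike. The new
domain has no new values other than `±χ d`, so it is again image-closed. -/
theorem IsCompatible.exists_adjoin_image (h : IsModel χ c) (h' : IsPrecontraction χ')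
    (he : IsValueMap χ χ' e) (hG : IsCompatible χ χ' e G) (hJ : IsImageClosed χ e G) {d : Γ}
    (hd : d ∈ negImage χ) :
    ∃ G' : Submodule ℚ (Γ × Γ'), G ≤ G' ∧ (d, e d) ∈ G' ∧ IsCompatible χ χ' e G' ∧
      IsImageClosed χ e G' := by
  by_cases hdG : (d, e d) ∈ G
  · exact ⟨G, le_rfl, hdG, hG, hJ⟩
  have hself : (d, e d) ∈ G ⊔ Submodule.span ℚ {(d, e d)} :=
    (le_sup_right : _ ≤ G ⊔ _) (Submodule.mem_span_singleton_self _)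
  have hne : ∀ p ∈ G, |χ p.1| ≠ |χ d| := by
    intro p hp heq
    rcases abs_eq_abs.1 heq with h1 | h1
    · exact hdG (hJ p hp d hd h1)
    · refine hdG (hJ (-p) (G.neg_mem hp) d hd ?_)
      rw [Prod.fst_neg, h.map_neg, h1, neg_neg]
  refine ⟨_, le_sup_left, hself, hG.sup_span h.toIsPrecontraction h' he fun p hp => ?_, ?_⟩
  · have hpd : |χ' p.2| = |e (χ p.1)| := by rw [hG p hp]
    have hed := he.map_map d hd
    rcases lt_or_gt_of_ne (hne p hp) with h1 | h1
    · rw [h.sub_eq_left h1, h'.sub_eq_left, hed]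
      rwa [hpd, hed, he.abs_lt_iff h.toIsPrecontraction]
    · rw [h.sub_eq_right h1, h'.sub_eq_right, hG p hp, he.map_neg]
      rwa [hpd, hed, he.abs_lt_iff h.toIsPrecontraction]
  · intro z hz d₂ hd₂ hzd
    -- The value `-χ d` is excluded because it is positive while `χ d₂` is negative.
    have hcase : (∃ p ∈ G, χ p.1 = χ d₂) ∨ χ d = χ d₂ := by
      rcases exists_smul_sub_of_mem_sup_span hz with hz | ⟨p, hp, q, hq, rfl⟩
      · exact Or.inl ⟨z, hz, hzd⟩
      · simp only [Prod.smul_fst, Prod.fst_sub] at hzd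
        have hd₂neg := h.neg_iff.2 (h.neg_of_mem hd₂)
        have hdneg := h.neg_iff.2 (h.neg_of_mem hd)
        have hneg : ∀ p ∈ G, -χ p.1 = χ d₂ → ∃ p ∈ G, χ p.1 = χ d₂ := fun p hp hpd =>
          ⟨-p, G.neg_mem hp, by rw [Prod.fst_neg, h.map_neg, hpd]⟩
        rcases lt_or_gt_of_ne (hne p hp) with h1 | h1
        · right
          have h2 := h.sub_eq_left h1
          rcases lt_or_gt_of_ne hq with hq | hq
          · rw [h.map_qsmul_of_neg hq, h2] at hzd
            rw [← hzd] at hd₂neg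
            exact absurd hd₂neg (not_lt.2 (neg_pos.2 hdneg).le)
          · rwa [h.map_qsmul hq, h2] at hzd
        · left
          have h2 := h.sub_eq_right h1
          rcases lt_or_gt_of_ne hq with hq | hq
          · rw [h.map_qsmul_of_neg hq, h2, neg_neg] at hzd
            exact ⟨p, hp, hzd⟩
          · rw [h.map_qsmul hq, h2] at hzd
            exact hneg p hp hzd
    rcases hcase with ⟨p, hp, hpd⟩ | hdd
    · exact (le_sup_left : G ≤ _) (hJ p hp d₂ hd₂ hpd)
    · rwa [← h.bijOn.injOn hd hd₂ hdd]

/-- The image `b'` must give every `b' - p.2` a prescribed value. Splitting each equation into two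
inequalities yields countably many cuts, so saturation leaves only pairs of conditions, which
`IsValueMap.exists_pair` solves. -/
theorem IsCompatible.exists_adjoin (h : IsPrecontraction χ) (h' : IsPrecontraction χ')
    (he : IsValueMap χ χ' e) (hs : CutSaturated χ') [Countable Γ] (hG : IsCompatible χ χ' e G)
    (b : Γ) :
    ∃ (G' : Submodule ℚ (Γ × Γ')) (b' : Γ'), G ≤ G' ∧ (b, b') ∈ G' ∧ IsCompatible χ χ' e G' := by
  have hGc : (G : Set (Γ × Γ')).Countable := by
    refine Set.MapsTo.countable_of_injOn (f := Prod.fst) (t := Set.univ) (fun _ _ => trivial) ?_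
      Set.countable_univ
    exact fun p hp q hq e => Prod.ext e (hG.snd_unique h h' he hp hq e)
  obtain ⟨b', hU, hV⟩ := hs
    ((fun p : Γ × Γ' => {y | e (χ (b - p.1)) ≤ χ'^[1] (y - p.2)}) '' G)
    ((fun p : Γ × Γ' => {y | χ'^[1] (y - p.2) ≤ e (χ (b - p.1))}) '' G)
    (hGc.image _) (hGc.image _) (Set.Nonempty.image _ ⟨0, G.zero_mem⟩)
    (Set.Nonempty.image _ ⟨0, G.zero_mem⟩)
    (by
      rintro _ ⟨p, -, rfl⟩
      exact ⟨_, _, _, rfl⟩)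
    (by
      rintro _ ⟨p, -, rfl⟩
      exact Or.inl ⟨_, _, _, rfl⟩)
    (by
      rintro _ ⟨p, hp, rfl⟩ _ ⟨q, hq, rfl⟩
      -- After translation by `p`, the two conditions concern `b - p` and its difference with `q -
      -- p`, which is `b - q`.
      obtain ⟨s, h1, h2⟩ := he.exists_pair h h' (hG (q - p) (G.sub_mem hq hp)) (b - p.1)
      rw [Prod.fst_sub, Prod.snd_sub, sub_sub_sub_cancel_right] at h2
      refine ⟨s + p.2, ?_, ?_⟩
      · change e (χ (b - p.1)) ≤ χ' (s + p.2 - p.2)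
        rw [add_sub_cancel_right, h1]
      · change χ' (s + p.2 - q.2) ≤ e (χ (b - q.1))
        rw [← h2, sub_sub_eq_add_sub])
  refine ⟨_, b', le_sup_left, (le_sup_right : _ ≤ G ⊔ _) (Submodule.mem_span_singleton_self _),
    hG.sup_span h h' he fun p hp => le_antisymm ?_ ?_⟩
  · exact hV _ ⟨p, hp, rfl⟩
  · exact hU _ ⟨p, hp, rfl⟩

/-- A maximal compatible and image-closed graph contains all of `χ(Γ^{<0})`. From then on
image-closedness is automatic for larger graphs, so arbitrary elements can be adjoined and
maximality makes the graph total. -/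
theorem IsCompatible.exists_total (h : IsModel χ c) (h' : IsPrecontraction χ')
    (he : IsValueMap χ χ' e) (hs : CutSaturated χ') [Countable Γ] (hG : IsCompatible χ χ' e G)
    (hJ : IsImageClosed χ e G) :
    ∃ G' : Submodule ℚ (Γ × Γ'), G ≤ G' ∧ IsCompatible χ χ' e G' ∧
      (∀ d ∈ negImage χ, (d, e d) ∈ G') ∧ ∀ x, ∃ y, (x, y) ∈ G' := by
  obtain ⟨G', hGG', hmax⟩ := zorn_le_nonempty₀
    {G : Submodule ℚ (Γ × Γ') | IsCompatible χ χ' e G ∧ IsImageClosed χ e G} (by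
      intro C hC hchain G₁ hG₁
      have hmem : ∀ {p}, p ∈ sSup C ↔ ∃ G ∈ C, p ∈ G := fun {p} =>
        Submodule.mem_sSup_of_directed ⟨G₁, hG₁⟩ hchain.directedOn
      refine ⟨sSup C, ⟨fun p hp => ?_, fun p hp d hd hpd => ?_⟩, fun G hG => le_sSup hG⟩
      · obtain ⟨G₂, h1, h2⟩ := hmem.1 hp
        exact (hC h1).1 p h2
      · obtain ⟨G₂, h1, h2⟩ := hmem.1 hp
        exact hmem.2 ⟨G₂, h1, (hC h1).2 p h2 d hd hpd⟩) G ⟨hG, hJ⟩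
  have hD : ∀ d ∈ negImage χ, (d, e d) ∈ G' := by
    intro d hd
    obtain ⟨G'', h1, h2, h3, h4⟩ :=
      hmax.prop.1.exists_adjoin_image h h' he hmax.prop.2 hd
    exact hmax.le_of_ge ⟨h3, h4⟩ h1 h2
  refine ⟨G', hGG', hmax.prop.1, hD, fun x => ?_⟩
  obtain ⟨G'', y, h1, h2, h3⟩ := hmax.prop.1.exists_adjoin h.toIsPrecontraction h' he hs x
  exact ⟨y, hmax.le_of_ge ⟨h3, fun _ _ d hd _ => h1 (hD d hd)⟩ h1 h2⟩

end Graphs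

end ValueMaps

end Pdg

namespace Pdg

/-! ### Partial isomorphisms of the expansions and their extension to embeddings. -/

section PartialIso

variable {Γ Γ' : Type*} [AddCommGroup Γ] [LinearOrder Γ] [AddCommGroup Γ'] [LinearOrder Γ']

/-- `R` is (the graph of) an isomorphism between substructures of the expansions of `(Γ, χ, c)` and
`(Γ', χ', c')`. -/
structure IsPartialIso (conv : Convention) (χ : Γ → Γ) (c : Γ) (χ' : Γ' → Γ') (c' : Γ')
    (R : WithTop Γ → WithTop Γ' → Prop) : Prop where
  zero : R 0 0
  const : R c c'
  neg : ∀ {x y}, R x y → R (WithTop.map (fun a : Γ => -a) x) (WithTop.map (fun a : Γ' => -a) y)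
  add : ∀ {x y x' y'}, R x y → R x' y' → R (x + x') (y + y')
  chi : ∀ {x y}, R x y → R (WithTop.map χ x) (WithTop.map χ' y)
  inv : ∀ {x y}, R x y → R (chiInv conv χ x) (chiInv conv χ' y)
  delta : ∀ (k : ℕ+) {x y}, R x y → R (divBy k x) (divBy k y)
  lt_iff : ∀ {x y x' y'}, R x y → R x' y' → (x < x' ↔ y < y')
  top_iff : ∀ {x y}, R x y → (x = ⊤ ↔ y = ⊤)

variable {conv : Convention} {χ : Γ → Γ} {c : Γ} {χ' : Γ' → Γ'} {c' : Γ'}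

section Values

variable [IsOrderedAddMonoid Γ]

theorem divBy_coe [Module ℚ Γ] (h : IsModel χ c) (k : ℕ+) (a : Γ) :
    divBy k (a : WithTop Γ) = (((k : ℚ)⁻¹ • a : Γ) : WithTop Γ) := by
  obtain ⟨b, hb, hba⟩ := divBy_spec h k a
  rw [hb, ← hba, ← Nat.cast_smul_eq_nsmul ℚ, smul_smul, inv_mul_cancel₀, one_smul]
  exact Nat.cast_ne_zero.2 k.ne_zero

theorem chiInv_zero (h : IsModel χ c) : chiInv conv χ ((0 : Γ) : WithTop Γ) = 0 := by
  have h1 : (0 : Γ) ∉ χ '' negImage χ := by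
    rintro ⟨d, hd, h0⟩
    exact (h.neg_of_mem hd).ne ((h.eq_zero_iff d).1 h0)
  simp only [chiInv, h1, if_false, if_true]

/-- Elements of `χ(Γ^{>0})` are positive, so the two conventions agree at negative arguments. -/
theorem chiInv_of_neg (h : IsModel χ c) {a : Γ} (ha : a < 0) (hD : a ∉ χ '' negImage χ) :
    chiInv conv χ (a : WithTop Γ) = ⊤ := by
  have h2 : -a ∉ χ '' negImage χ := by
    rintro ⟨d, hd, h0⟩
    exact lt_asymm (neg_pos.2 ha) (h0 ▸ h.neg_of_mem (h.map_mem hd))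
  cases conv <;> simp only [chiInv, hD, ha.ne, h2, if_false]

theorem chiInv_infty_of_pos (h : IsModel χ c) {a : Γ} (ha : 0 < a) :
    chiInv .infty χ (a : WithTop Γ) = ⊤ := by
  have h2 : a ∉ χ '' negImage χ := by
    rintro ⟨d, hd, h0⟩
    exact lt_asymm ha (h0 ▸ h.neg_of_mem (h.map_mem hd))
  simp only [chiInv, h2, ha.ne', if_false]

theorem chiInv_odd_of_pos (h : IsModel χ c) {a : Γ} (ha : 0 < a) :
    chiInv .odd χ (a : WithTop Γ) =
      WithTop.map (fun a : Γ => -a) (chiInv .odd χ ((-a : Γ) : WithTop Γ)) := by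
  have h2 : a ∉ χ '' negImage χ := by
    rintro ⟨d, hd, h0⟩
    exact lt_asymm ha (h0 ▸ h.neg_of_mem (h.map_mem hd))
  by_cases h1 : -a ∈ χ '' negImage χ
  · simp only [chiInv, h2, h1, ha.ne', if_false, if_true, WithTop.map_coe]
  · rw [chiInv_of_neg h (neg_neg_of_pos ha) h1]
    simp only [chiInv, h2, h1, ha.ne', if_false, WithTop.map_top]

end Values

namespace IsPartialIso

variable {R : WithTop Γ → WithTop Γ' → Prop} (hR : IsPartialIso conv χ c χ' c' R)
include hR

theorem neg_coe {x : Γ} {y : Γ'} (hxy : R x y) : R (-x : Γ) (-y : Γ') := hR.neg hxy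

theorem add_coe {x x' : Γ} {y y' : Γ'} (hxy : R x y) (hxy' : R x' y') :
    R (x + x' : Γ) (y + y' : Γ') := hR.add hxy hxy'

theorem chi_coe {x : Γ} {y : Γ'} (hxy : R x y) : R (χ x : Γ) (χ' y : Γ') := hR.chi hxy

theorem iterate_coe {x : Γ} {y : Γ'} (hxy : R x y) (n : ℕ) : R (χ^[n] x : Γ) (χ'^[n] y : Γ') := by
  induction n with
  | zero => exact hxy
  | succ n ih =>
    rw [Function.iterate_succ_apply', Function.iterate_succ_apply']
    exact hR.chi_coe ih

theorem lt_coe_iff {x x' : Γ} {y y' : Γ'} (hxy : R x y) (hxy' : R x' y') : x < x' ↔ y < y' :=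
  WithTop.coe_lt_coe.symm.trans ((hR.lt_iff hxy hxy').trans WithTop.coe_lt_coe)

theorem neg_iff {x : Γ} {y : Γ'} (hxy : R x y) : x < 0 ↔ y < 0 := hR.lt_coe_iff hxy hR.zero

theorem pos_iff {x : Γ} {y : Γ'} (hxy : R x y) : 0 < x ↔ 0 < y := hR.lt_coe_iff hR.zero hxy

theorem exists_coe {x : Γ} {y : WithTop Γ'} (hxy : R x y) : ∃ y' : Γ', y = y' := by
  have : y ≠ ⊤ := fun e => WithTop.coe_ne_top ((hR.top_iff hxy).2 e)
  exact ⟨y.untop this, (WithTop.coe_untop y this).symm⟩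

theorem nsmul_coe {x : Γ} {y : Γ'} (hxy : R x y) (n : ℕ) : R (n • x : Γ) (n • y : Γ') := by
  induction n with
  | zero => rw [zero_nsmul, zero_nsmul]; exact hR.zero
  | succ n ih => rw [succ_nsmul, succ_nsmul]; exact hR.add_coe ih hxy

theorem zsmul_coe {x : Γ} {y : Γ'} (hxy : R x y) (n : ℤ) : R (n • x : Γ) (n • y : Γ') := by
  obtain ⟨n, rfl | rfl⟩ := n.eq_nat_or_neg
  · rw [natCast_zsmul, natCast_zsmul]; exact hR.nsmul_coe hxy n
  · rw [neg_zsmul, neg_zsmul, natCast_zsmul, natCast_zsmul]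
    exact hR.neg_coe (hR.nsmul_coe hxy n)

variable [IsOrderedAddMonoid Γ] [IsOrderedAddMonoid Γ']

theorem isImageIso (h : IsModel χ c) (h' : IsModel χ' c') :
    IsImageIso χ c χ' c' {p | R p.1 p.2 ∧ p.1 ∈ negImage χ ∧ p.2 ∈ negImage χ'} where
  mem_left _ hp := hp.2.1
  mem_right _ hp := hp.2.2
  least := ⟨hR.const, h.isLeast.1, h'.isLeast.1⟩
  le _ hp _ hq m n hl := not_lt.1 fun hlt => not_lt.2 hl
    ((hR.lt_coe_iff (hR.iterate_coe hq.1 n) (hR.iterate_coe hp.1 m)).2 hlt)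

variable [Module ℚ Γ] [Module ℚ Γ']

theorem qsmul_coe (h : IsModel χ c) (h' : IsModel χ' c') {x : Γ} {y : Γ'} (hxy : R x y) (q : ℚ) :
    R (q • x : Γ) (q • y : Γ') := by
  obtain ⟨k, hk⟩ : ∃ k : ℕ+, (k : ℕ) = q.den := ⟨⟨q.den, q.den_pos⟩, rfl⟩
  have h1 := hR.delta k (hR.zsmul_coe hxy q.num)
  have hq : (k : ℚ)⁻¹ * (q.num : ℚ) = q := by
    rw [inv_mul_eq_div, hk, Rat.num_div_den]
  rwa [divBy_coe h, divBy_coe h', ← Int.cast_smul_eq_zsmul ℚ, ← Int.cast_smul_eq_zsmul ℚ,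
    smul_smul, smul_smul, hq] at h1

/-- The graph of a partial isomorphism on the finite elements. -/
def graph (h : IsModel χ c) (h' : IsModel χ' c') : Submodule ℚ (Γ × Γ') where
  carrier := {p | R p.1 p.2}
  add_mem' hp hq := hR.add_coe hp hq
  zero_mem' := hR.zero
  smul_mem' q _ hp := hR.qsmul_coe h h' hp q

/-- The partial isomorphism restricts to the images `χ(Γ^{<0})`, extends there by saturation, and is
then prolonged oddly. Compatibility holds since `R` commutes with `χ`; image-closedness holds since
it commutes with `χ⁻¹`. -/
theorem exists_valueMap (h : IsModel χ c) (h' : IsModel χ' c') (hs : CutSaturated χ')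
    [Countable Γ] :
    ∃ e : Γ → Γ', IsValueMap χ χ' e ∧ e c = c' ∧ IsCompatible χ χ' e (hR.graph h h') ∧
      IsImageClosed χ e (hR.graph h h') := by
  obtain ⟨e₀, h1, h2, h3, h4⟩ := (hR.isImageIso h h').exists_total h h' hs
  obtain ⟨e, he, hee⟩ := exists_isValueMap h h' h2 h3 h4
  have hE : ∀ (x : Γ) (y : Γ'), R x y → x ∈ negImage χ → y ∈ negImage χ' → e x = y :=
    fun x y hxy hx hy => (hee x hx).trans (h1 (x, y) ⟨hxy, hx, hy⟩)
  refine ⟨e, he, hE _ _ hR.const h.isLeast.1 h'.isLeast.1, ?_, ?_⟩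
  · have hneg : ∀ (x : Γ) (y : Γ'), R x y → x < 0 → χ' y = e (χ x) := fun x y hxy hx =>
      (hE _ _ (hR.chi_coe hxy) ⟨x, hx, rfl⟩ ⟨y, (hR.neg_iff hxy).1 hx, rfl⟩).symm
    rintro ⟨x, y⟩ hxy
    change R x y at hxy
    change χ' y = e (χ x)
    rcases lt_trichotomy x 0 with hx | rfl | hx
    · exact hneg x y hxy hx
    · have hy : y = 0 := by
        refine le_antisymm (not_lt.1 fun hy => ?_) (not_lt.1 fun hy => ?_)
        · exact lt_irrefl _ ((hR.pos_iff hxy).2 hy)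
        · exact lt_irrefl _ ((hR.neg_iff hxy).2 hy)
      rw [hy, h'.map_zero, h.map_zero, he.map_zero h.toIsPrecontraction]
    · have := hneg (-x) (-y) (hR.neg_coe hxy) (neg_neg_of_pos hx)
      rwa [h'.map_neg, h.map_neg, he.map_neg, neg_inj] at this
  · rintro ⟨x, y⟩ hxy d hd hxd
    change R x y at hxy
    change R d (e d)
    change χ x = χ d at hxd
    -- Here `χ⁻¹ (χ x) = d`, so `d` lies in the domain. Its partner is finite, which forces `χ' y`
    -- into the range where `χ⁻¹` inverts `χ'`.
    have h5 := hR.inv (hR.chi_coe hxy)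
    rw [hxd, chiInv_eq h hd] at h5
    obtain ⟨d', hd'⟩ := hR.exists_coe h5
    have hx : x < 0 := h.neg_iff.1 (hxd ▸ h.neg_iff.2 (h.neg_of_mem hd))
    have hy := h'.neg_iff.2 ((hR.neg_iff hxy).1 hx)
    have hyD : χ' y ∈ χ' '' negImage χ' := by
      by_contra hn
      rw [chiInv_of_neg h' hy hn] at hd'
      exact WithTop.top_ne_coe hd'
    obtain ⟨d'', hd'', he''⟩ := hyD
    rw [← he'', chiInv_eq h' hd''] at h5
    rw [hE d d'' h5 hd hd'']
    exact h5

end IsPartialIso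

/-- An everywhere defined map as in `IsCompatible` is an embedding of the expansions. -/
theorem IsCompatible.isPartialIso_map [IsOrderedAddMonoid Γ] [IsOrderedAddMonoid Γ'] [Module ℚ Γ]
    [Module ℚ Γ'] (h : IsModel χ c) (h' : IsModel χ' c') {e : Γ → Γ'} (he : IsValueMap χ χ' e)
    (hc : e c = c') {G : Submodule ℚ (Γ × Γ')} (hG : IsCompatible χ χ' e G)
    (hD : ∀ d ∈ negImage χ, (d, e d) ∈ G) {f : Γ → Γ'} (hf : ∀ x, (x, f x) ∈ G) :
    IsPartialIso conv χ c χ' c' fun x y => WithTop.map f x = y := by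
  have hfe : ∀ x y, (x, y) ∈ G → f x = y := fun x y hxy =>
    hG.snd_unique h.toIsPrecontraction h'.toIsPrecontraction he (hf x) hxy rfl
  have fD : ∀ d ∈ negImage χ, f d = e d := fun d hd => hfe _ _ (hD d hd)
  have f0 : f 0 = 0 := hfe _ _ G.zero_mem
  have fneg : ∀ x, f (-x) = -f x := fun x => hfe _ _ (G.neg_mem (hf x))
  have fadd : ∀ x y, f (x + y) = f x + f y := fun x y => hfe _ _ (G.add_mem (hf x) (hf y))
  have fsmul : ∀ (q : ℚ) x, f (q • x) = q • f x := fun q x => hfe _ _ (G.smul_mem q (hf x))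
  have flt : ∀ x y, x < y ↔ f x < f y := by
    intro x y
    have := hG.snd_neg_iff h.toIsPrecontraction h'.toIsPrecontraction he
      (G.sub_mem (hf x) (hf y))
    rw [Prod.fst_sub, Prod.snd_sub, sub_neg, sub_neg] at this
    exact this.symm
  have fmono : StrictMono f := fun x y => (flt x y).1
  have finj : Function.Injective f := fmono.injective
  have fχneg : ∀ x < 0, f (χ x) = χ' (f x) := fun x hx => by
    rw [fD _ ⟨x, hx, rfl⟩, hG _ (hf x)]
  have fχ : ∀ x, f (χ x) = χ' (f x) := by
    intro x
    rcases lt_trichotomy x 0 with hx | rfl | hx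
    · exact fχneg x hx
    · rw [h.map_zero, f0, h'.map_zero]
    · have := fχneg (-x) (neg_neg_of_pos hx)
      rwa [h.map_neg, fneg, fneg, h'.map_neg, neg_inj] at this
  have fnegIff : ∀ x, x < 0 ↔ f x < 0 := fun x => by rw [flt, f0]
  have hmem : ∀ d ∈ negImage χ, f d ∈ negImage χ' := fun d hd => by
    rw [fD d hd]
    exact he.mem d hd
  -- Needed for `χ⁻¹` to take the value `∞` at corresponding places. From `f c = c'` one gets `c < χ
  -- a`, so `χ a = χ p` with `p` in the image; injectivity of `χ'` on its image gives `f p = f a`,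
  -- hence `a = p`, and `a` lies above `c`.
  have hrefl : ∀ a : Γ, f a ∈ χ' '' negImage χ' → a ∈ χ '' negImage χ := by
    rintro a ⟨d', hd', hd'a⟩
    have hfc : f c = c' := (fD c h.isLeast.1).trans hc
    have hfaD : f a ∈ negImage χ' := hd'a ▸ h'.map_mem hd'
    have ha : a < 0 := (fnegIff a).2 (h'.neg_of_mem hfaD)
    have hc'a : c' < f a := by
      rw [← hd'a]
      exact (h'.isLeast.2 hd').trans_lt (h'.lt_map (h'.neg_of_mem hd'))
    have h1 : c < χ a := by
      rw [flt, hfc, fχ]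
      exact hc'a.trans (h'.lt_map (h'.neg_of_mem hfaD))
    obtain ⟨p, hp, hpa⟩ := h.bijOn.surjOn ⟨⟨a, ha, rfl⟩, h1⟩
    have h2 : f p = f a := by
      refine h'.bijOn.injOn (hmem p hp) hfaD ?_
      rw [← fχ, ← fχ, hpa]
    rw [← finj h2]
    refine h.bijOn.surjOn ⟨hp, ?_⟩
    change c < p
    rw [flt, hfc, h2]
    exact hc'a
  have finvneg : ∀ (conv : Convention) (a : Γ), a < 0 →
      WithTop.map f (chiInv conv χ (a : WithTop Γ)) =
      chiInv conv χ' (f a : WithTop Γ') := by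
    intro conv a ha
    by_cases haD : a ∈ χ '' negImage χ
    · obtain ⟨d, hd, rfl⟩ := haD
      rw [chiInv_eq h hd, fχ, chiInv_eq h' (hmem d hd), WithTop.map_coe]
    · rw [chiInv_of_neg h ha haD, chiInv_of_neg h' ((fnegIff a).1 ha) fun h3 => haD (hrefl a h3),
        WithTop.map_top]
  have mneg : ∀ x : WithTop Γ, WithTop.map f (WithTop.map (fun a : Γ => -a) x) =
      WithTop.map (fun a : Γ' => -a) (WithTop.map f x) := by
    intro x
    cases x with
    | top => rfl
    | coe a => exact congrArg _ (fneg a)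
  have fpos : ∀ x, 0 < x → 0 < f x := fun x hx => by rwa [← f0, ← flt]
  refine ⟨congrArg _ f0, congrArg _ ((fD c h.isLeast.1).trans hc), ?_, ?_, ?_, ?_, ?_, ?_, ?_⟩
  · rintro x _ rfl
    exact mneg x
  · rintro x _ x' _ rfl rfl
    cases x with
    | top => rw [WithTop.map_top, WithTop.top_add, WithTop.top_add, WithTop.map_top]
    | coe a =>
      cases x' with
      | top => rw [WithTop.map_top, WithTop.add_top, WithTop.add_top, WithTop.map_top]
      | coe b => exact congrArg _ (fadd a b)
  · rintro x _ rfl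
    cases x with
    | top => rfl
    | coe a => exact congrArg _ (fχ a)
  · rintro x _ rfl
    cases x with
    | top => rfl
    | coe a =>
      rw [WithTop.map_coe]
      rcases lt_trichotomy a 0 with ha | rfl | ha
      · exact finvneg conv a ha
      · rw [f0, chiInv_zero h, chiInv_zero h']
        exact congrArg _ f0
      · cases conv with
        | infty =>
          rw [chiInv_infty_of_pos h ha, chiInv_infty_of_pos h' (fpos a ha), WithTop.map_top]
        | odd =>
          rw [chiInv_odd_of_pos h ha, chiInv_odd_of_pos h' (fpos a ha), mneg,
            finvneg _ _ (neg_neg_of_pos ha), fneg]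
  · rintro k x _ rfl
    cases x with
    | top => rfl
    | coe a => rw [WithTop.map_coe, divBy_coe h, divBy_coe h', WithTop.map_coe, fsmul]
  · rintro x _ x' _ rfl rfl
    cases x' with
    | top =>
      cases x with
      | top => simp
      | coe a => simp
    | coe b =>
      cases x with
      | top => simp
      | coe a => exact WithTop.coe_lt_coe.trans ((flt a b).trans WithTop.coe_lt_coe.symm)
  · rintro x _ rfl
    cases x with
    | top => simp
    | coe a => simp

/-- A partial isomorphism from a countable model to a saturated one extends to an embedding. -/
theorem IsPartialIso.exists_map [IsOrderedAddMonoid Γ] [IsOrderedAddMonoid Γ'] [Module ℚ Γ]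
    [Module ℚ Γ'] (h : IsModel χ c) (h' : IsModel χ' c') (hs : CutSaturated χ') [Countable Γ]
    {R : WithTop Γ → WithTop Γ' → Prop} (hR : IsPartialIso conv χ c χ' c' R) :
    ∃ f : Γ → Γ', (IsPartialIso conv χ c χ' c' fun x y => WithTop.map f x = y) ∧
      ∀ x y, R x y → WithTop.map f x = y := by
  obtain ⟨e, he, hc, hG₀, hJ⟩ := hR.exists_valueMap h h' hs
  obtain ⟨G, hG₀G, hG, hD, htot⟩ := hG₀.exists_total h h'.toIsPrecontraction he hs hJ
  choose f hf using htot
  refine ⟨f, hG.isPartialIso_map h h' he hc hD hf, fun x y hxy => ?_⟩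
  cases x with
  | top => exact ((hR.top_iff hxy).1 rfl).symm
  | coe a =>
    obtain ⟨b, rfl⟩ := hR.exists_coe hxy
    exact congrArg _ (hG.snd_unique h.toIsPrecontraction h'.toIsPrecontraction he (hf a)
      (hG₀G (x := (a, b)) hxy) rfl)

end PartialIso

end Pdg

/-! ### Passing between the first-order structures and the groups: transfer, definable cuts,
assembly. -/

namespace FirstOrder.Language

theorem CountablySaturated.of_equiv {L : Language.{0, 0}} {N N' : Type} [L.Structure N]
    [L.Structure N'] (hN : CountablySaturated L N) (e : N ≃[L] N') : CountablySaturated L N' := by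
  intro φ hφ
  have key : ∀ k (x : N), ((φ k).relabel (Sum.map e.symm id)).Realize (Sum.elim id fun _ => x) ↔
      (φ k).Realize (Sum.elim id fun _ => e x) := by
    intro k x
    rw [Formula.realize_relabel, ← StrongHomClass.realize_formula e]
    refine iff_of_eq (congrArg _ (funext fun i => ?_))
    rcases i with a | a
    · exact e.apply_symm_apply a
    · rfl
  obtain ⟨x, hx⟩ := hN (fun k => (φ k).relabel (Sum.map e.symm id)) fun n => by
    obtain ⟨x, hx⟩ := hφ n
    refine ⟨e.symm x, fun k hk => (key k _).2 ?_⟩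
    rw [e.apply_symm_apply]
    exact hx k hk
  exact ⟨e x, fun k => (key k x).1 (hx k)⟩

theorem SameAtomicType.comp_embedding {L : Language.{0, 0}} {M N M' N' β : Type} [L.Structure M]
    [L.Structure N] [L.Structure M'] [L.Structure N'] {v : β → M} {w : β → N}
    (h : SameAtomicType L v w) (f : M ↪[L] M') (g : N ↪[L] N') :
    SameAtomicType L (f ∘ v) (g ∘ w) where
  eq_iff s t := by
    simp only [HomClass.realize_term, EmbeddingLike.apply_eq_iff_eq, h.eq_iff]
  rel_iff R t := by
    simp only [HomClass.realize_term]
    exact (f.map_rel R _).trans ((h.rel_iff R t).trans (g.map_rel R _).symm)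

end FirstOrder.Language

namespace Pdg

open FirstOrder FirstOrder.Language

theorem card_lang_le : Lang.card ≤ Cardinal.aleph0 := by
  have h1 : Countable (Σ n, Lang.Functions n) := by
    let code : (Σ n, Func n) → ℕ := fun f => match f with
      | ⟨_, .zero⟩ => 0
      | ⟨_, .c⟩ => 1
      | ⟨_, .infty⟩ => 2
      | ⟨_, .neg⟩ => 3
      | ⟨_, .chi⟩ => 4
      | ⟨_, .chiInv⟩ => 5
      | ⟨_, .add⟩ => 6
      -- Since `n ≥ 1`, these codes start at `7` and avoid the preceding ones.
      | ⟨_, .delta n⟩ => 6 + n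
    refine Function.Injective.countable (f := code) ?_
    rintro ⟨_, f⟩ ⟨_, g⟩ hfg
    have hpos : ∀ k : ℕ+, 0 < (k : ℕ) := fun k => k.pos
    cases f <;> cases g <;> first
      | rfl
      | (simp only [code] at hfg; omega)
      | (rename_i k; have := hpos k; simp only [code] at hfg; omega)
      | (simp only [code, Nat.add_left_cancel_iff, PNat.coe_inj] at hfg; rw [hfg])
  have h2 : Countable (Σ n, Lang.Relations n) := by
    have : Subsingleton (Σ n, Rel n) := ⟨by rintro ⟨_, _ | _⟩ ⟨_, _ | _⟩; rfl⟩
    exact (inferInstance : Countable (Σ n, Rel n))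
  have : Countable Lang.Symbols := by
    unfold Language.Symbols
    infer_instance
  exact Cardinal.mk_le_aleph0

section Glue

variable {Γ : Type} {χ : Γ → Γ}

theorem iterate_map_coe (n : ℕ) (a : Γ) :
    (WithTop.map χ)^[n] (a : WithTop Γ) = ((χ^[n] a : Γ) : WithTop Γ) := by
  induction n with
  | zero => rfl
  | succ n ih =>
    rw [Function.iterate_succ_apply', ih, Function.iterate_succ_apply', WithTop.map_coe]

theorem iterate_map_top (n : ℕ) : (WithTop.map χ)^[n] ⊤ = ⊤ := by
  induction n with
  | zero => rfl
  | succ n ih => rw [Function.iterate_succ_apply', ih, WithTop.map_top]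

variable {conv : Convention} {c : Γ} [AddCommGroup Γ] [LinearOrder Γ]

section Formulas

variable {α : Type}

/-- The term `χⁿ(s + t)`. -/
def iterateChiTerm (n : ℕ) (s t : Lang.Term α) : Lang.Term α :=
  (Functions.apply₁ (L := Lang) Func.chi)^[n] (Functions.apply₂ (L := Lang) Func.add s t)

theorem realize_iterateChiTerm (n : ℕ) (s t : Lang.Term α) (v : α → WithTop Γ) :
    letI := expansion conv χ c
    (iterateChiTerm n s t).realize v = (WithTop.map χ)^[n] (s.realize v + t.realize v) := by
  let _ := expansion conv χ c
  change (iterateChiTerm n s t).realize v = _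
  induction n with
  | zero => exact Term.realize_functions_apply₂
  | succ n ih =>
    rw [Function.iterate_succ_apply', ← ih, iterateChiTerm, Function.iterate_succ_apply']
    exact Term.realize_functions_apply₁

theorem realize_iterateChiTerm_sub (n : ℕ) (a : Γ) (x : WithTop Γ) :
    letI := expansion conv χ c
    (iterateChiTerm n (Term.var (Sum.inr ())) (Term.var (Sum.inl ((-a : Γ) : WithTop Γ)))).realize
      (Sum.elim id fun _ : Unit => x) = WithTop.map (fun x => χ^[n] (x - a)) x := by
  let _ := expansion conv χ c
  refine (realize_iterateChiTerm n _ _ _).trans ?_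
  cases x with
  | top => exact iterate_map_top n
  | coe x =>
    refine Eq.trans ?_ (iterate_map_coe n (x - a))
    rw [sub_eq_add_neg]
    rfl

/-- The formula `s < t`. -/
def ltFormula (s t : Lang.Term α) : Lang.Formula α := Relations.formula₂ (L := Lang) Rel.lt s t

theorem realize_ltFormula (s t : Lang.Term α) (v : α → WithTop Γ) :
    letI := expansion conv χ c
    (ltFormula s t).Realize v ↔ s.realize v < t.realize v := by
  let _ := expansion conv χ c
  exact Formula.realize_rel₂

/-- The formula also holds at `∞`, so it is controlled on `Γ` only; the lower cuts are what excludes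
`∞`. -/
theorem IsUpperCut.exists_formula {U : Set Γ} (hU : IsUpperCut χ U) :
    letI := expansion conv χ c
    ∃ φ : Lang.Formula (WithTop Γ ⊕ Unit), ∀ x : Γ,
      φ.Realize (Sum.elim id fun _ => (x : WithTop Γ)) ↔ x ∈ U := by
  let _ := expansion conv χ c
  obtain ⟨n, a, p, rfl⟩ := hU
  refine ⟨(ltFormula
    (iterateChiTerm n (Term.var (Sum.inr ())) (Term.var (Sum.inl ((-a : Γ) : WithTop Γ))))
    (Term.var (Sum.inl (p : WithTop Γ)))).not, fun x => ?_⟩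
  rw [Formula.realize_not, realize_ltFormula, realize_iterateChiTerm_sub]
  change ¬ ((χ^[n] (x - a) : Γ) : WithTop Γ) < (p : WithTop Γ) ↔ _
  rw [WithTop.coe_lt_coe, not_lt]
  rfl

theorem IsLowerCut.exists_formula {V : Set Γ} (hV : IsLowerCut χ V) :
    letI := expansion conv χ c
    ∃ φ : Lang.Formula (WithTop Γ ⊕ Unit), ∀ x : WithTop Γ,
      φ.Realize (Sum.elim id fun _ => x) ↔ ∃ a ∈ V, x = (a : WithTop Γ) := by
  let _ := expansion conv χ c
  rcases hV with ⟨n, a, p, rfl⟩ | rfl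
  · refine ⟨(ltFormula (Term.var (Sum.inl (p : WithTop Γ)))
      (iterateChiTerm n (Term.var (Sum.inr ())) (Term.var (Sum.inl ((-a : Γ) : WithTop Γ))))).not,
      fun x => ?_⟩
    rw [Formula.realize_not, realize_ltFormula, realize_iterateChiTerm_sub]
    change ¬ (p : WithTop Γ) < WithTop.map (fun x => χ^[n] (x - a)) x ↔ _
    cases x with
    | top =>
      refine iff_of_false (not_not.2 (WithTop.coe_lt_top p)) ?_
      rintro ⟨b, -, hb⟩
      exact WithTop.top_ne_coe hb
    | coe x =>
      rw [WithTop.map_coe, WithTop.coe_lt_coe, not_lt]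
      constructor
      · exact fun h => ⟨x, h, rfl⟩
      · rintro ⟨b, hb, hxb⟩
        rw [WithTop.coe_inj.1 hxb]
        exact hb
  · refine ⟨ltFormula (Term.var (Sum.inr ())) (Term.var (Sum.inl ((0 : Γ) : WithTop Γ))),
      fun x => ?_⟩
    rw [realize_ltFormula]
    change x < ((0 : Γ) : WithTop Γ) ↔ _
    cases x with
    | top =>
      refine iff_of_false not_top_lt ?_
      rintro ⟨b, -, hb⟩
      exact WithTop.top_ne_coe hb
    | coe x =>
      rw [WithTop.coe_lt_coe]
      constructor
      · exact fun h => ⟨x, h, rfl⟩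
      · rintro ⟨b, hb, hxb⟩
        rw [WithTop.coe_inj.1 hxb]
        exact hb

end Formulas

section Embeddings

variable {Γ' : Type} [AddCommGroup Γ'] [LinearOrder Γ']
  {χ' : Γ' → Γ'} {c' : Γ'}

/-- The generated substructures are matched term by term. The order is preserved by agreement on
`<`, and finiteness by agreement on equations with the constant `∞`. -/
theorem isPartialIso_of_sameAtomicType {β : Type} {v : β → WithTop Γ} {w : β → WithTop Γ'}
    (hvw : letI := expansion conv χ c; letI := expansion conv χ' c'; SameAtomicType Lang v w) :
    letI := expansion conv χ c; letI := expansion conv χ' c';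
    IsPartialIso conv χ c χ' c' fun x y =>
      ∃ t : Lang.Term β, t.realize v = x ∧ t.realize w = y := by
  let _ := expansion conv χ c
  let _ := expansion conv χ' c'
  change SameAtomicType Lang v w at hvw
  have app₁ : ∀ (F : Func 1) (t : Lang.Term β),
      ∃ s : Lang.Term β, s.realize v = Structure.funMap (L := Lang) F ![t.realize v] ∧
        s.realize w = Structure.funMap (L := Lang) F ![t.realize w] := fun F t =>
    ⟨Functions.apply₁ (L := Lang) F t, Term.realize_functions_apply₁,
      Term.realize_functions_apply₁⟩
  refine ⟨?_, ?_, ?_, ?_, ?_, ?_, ?_, ?_, ?_⟩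
  · exact ⟨Term.func (L := Lang) Func.zero ![], rfl, rfl⟩
  · exact ⟨Term.func (L := Lang) Func.c ![], rfl, rfl⟩
  · rintro _ _ ⟨t, rfl, rfl⟩
    exact app₁ Func.neg t
  · rintro _ _ _ _ ⟨s, rfl, rfl⟩ ⟨t, rfl, rfl⟩
    exact ⟨Functions.apply₂ (L := Lang) Func.add s t, Term.realize_functions_apply₂,
      Term.realize_functions_apply₂⟩
  · rintro _ _ ⟨t, rfl, rfl⟩
    exact app₁ Func.chi t
  · rintro _ _ ⟨t, rfl, rfl⟩
    exact app₁ Func.chiInv t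
  · rintro k _ _ ⟨t, rfl, rfl⟩
    exact app₁ (Func.delta k) t
  · rintro _ _ _ _ ⟨s, rfl, rfl⟩ ⟨t, rfl, rfl⟩
    have := hvw.rel_iff (k := 2) Rel.lt ![s, t]
    exact this
  · rintro _ _ ⟨t, rfl, rfl⟩
    exact hvw.eq_iff t (Term.func (L := Lang) Func.infty ![])

theorem IsPartialIso.exists_embedding {f : Γ → Γ'}
    (hf : IsPartialIso conv χ c χ' c' fun x y => WithTop.map f x = y) :
    letI := expansion conv χ c; letI := expansion conv χ' c';
    ∃ g : WithTop Γ ↪[Lang] WithTop Γ', ∀ x, g x = WithTop.map f x := by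
  let _ := expansion conv χ c
  let _ := expansion conv χ' c'
  have hlt : ∀ x y : WithTop Γ, x < y ↔ WithTop.map f x < WithTop.map f y := fun x y =>
    hf.lt_iff rfl rfl
  have hmono : StrictMono (WithTop.map f) := fun x y => (hlt x y).1
  refine ⟨{ toFun := WithTop.map f, inj' := hmono.injective, map_fun' := ?_, map_rel' := ?_ },
    fun _ => rfl⟩
  · intro n F x
    cases F with
    | zero => exact hf.zero
    | c => exact hf.const
    | infty => rfl
    | neg => exact hf.neg rfl
    | chi => exact hf.chi rfl
    | chiInv => exact hf.inv rfl
    | delta k => exact hf.delta k rfl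
    | add => exact hf.add rfl rfl
  · intro n R x
    cases R with
    | lt => exact (hlt _ _).symm

end Embeddings

/-- Cuts of one kind form a chain, so finitely many reduce to the smallest. This is how pairwise
compatibility gives finite satisfiability. -/
theorem exists_subset_of_total {X : Type} (f : ℕ → Set X) (hf : ∀ i j, f i ⊆ f j ∨ f j ⊆ f i)
    (n : ℕ) : ∃ i, ∀ k < n, f i ⊆ f k := by
  induction n with
  | zero => exact ⟨0, fun k hk => absurd hk (Nat.not_lt_zero k)⟩
  | succ n ih =>
    obtain ⟨i, hi⟩ := ih
    rcases hf i n with h | h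
    · refine ⟨i, fun k hk => ?_⟩
      rcases Nat.lt_succ_iff_lt_or_eq.1 hk with hk | rfl
      exacts [hi k hk, h]
    · refine ⟨n, fun k hk => ?_⟩
      rcases Nat.lt_succ_iff_lt_or_eq.1 hk with hk | rfl
      exacts [h.trans (hi k hk), subset_rfl]

variable [IsOrderedAddMonoid Γ]

/-- A divisible ordered group is its own divisible hull, whose rational structure is transported
back. -/
theorem IsModel.nonempty_module (h : IsModel χ c) : Nonempty (Module ℚ Γ) := by
  have hinj : Function.Injective (DivisibleHull.coeAddMonoidHom Γ) := DivisibleHull.coe_injective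
  have hsurj : Function.Surjective (DivisibleHull.coeAddMonoidHom Γ) := by
    intro x
    induction x with
    | mk m s =>
      obtain ⟨b, hb⟩ := h.divisible s s.pos m
      refine ⟨b, ?_⟩
      change DivisibleHull.mk b 1 = _
      rw [DivisibleHull.mk_eq_mk_iff_smul_eq_smul, ← hb]
      simp
  exact ⟨(AddEquiv.ofBijective _ ⟨hinj, hsurj⟩).module ℚ⟩

theorem IsUpperCut.isUpperSet (h : IsPrecontraction χ) {U : Set Γ} (hU : IsUpperCut χ U) :
    IsUpperSet U := by
  obtain ⟨n, a, p, rfl⟩ := hU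
  exact fun x y hxy hx => hx.trans (h.monotone.iterate n (sub_le_sub_right hxy a))

theorem IsLowerCut.isLowerSet (h : IsPrecontraction χ) {V : Set Γ} (hV : IsLowerCut χ V) :
    IsLowerSet V := by
  rcases hV with ⟨n, a, p, rfl⟩ | rfl
  · exact fun x y hxy hx => (h.monotone.iterate n (sub_le_sub_right hxy a)).trans hx
  · exact isLowerSet_Iio 0

theorem CutSaturated.of_countablySaturated (h : IsPrecontraction χ)
    (hs : letI := expansion conv χ c; CountablySaturated Lang (WithTop Γ)) : CutSaturated χ := by
  let _ := expansion conv χ c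
  change CountablySaturated Lang (WithTop Γ) at hs
  intro 𝒰 𝒱 hUc hVc hUn hVn hU hV hUV
  obtain ⟨U, rfl⟩ := hUc.exists_eq_range hUn
  obtain ⟨V, rfl⟩ := hVc.exists_eq_range hVn
  rw [Set.forall_mem_range] at hU hV
  choose φ hφ using fun k => (hU k).exists_formula (conv := conv) (c := c)
  choose ψ hψ using fun k => (hV k).exists_formula (conv := conv) (c := c)
  obtain ⟨x, hx⟩ := hs (fun k => φ k ⊓ ψ k) fun n => by
    obtain ⟨i, hi⟩ := exists_subset_of_total U
      (fun i j => ((hU i).isUpperSet h).total ((hU j).isUpperSet h)) n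
    obtain ⟨j, hj⟩ := exists_subset_of_total V
      (fun i j => ((hV i).isLowerSet h).total ((hV j).isLowerSet h)) n
    obtain ⟨x, hxU, hxV⟩ := hUV _ ⟨i, rfl⟩ _ ⟨j, rfl⟩
    refine ⟨x, fun k hk => Formula.realize_inf.2 ⟨?_, ?_⟩⟩
    · exact (hφ k x).2 (hi k hk hxU)
    · exact (hψ k x).2 ⟨x, hj k hk hxV, rfl⟩
  have hx' := fun k => Formula.realize_inf.1 (hx k)
  -- Any one lower cut shows that the solution is not `∞`; this uses that `𝒱` is nonempty.
  obtain ⟨a, -, rfl⟩ := (hψ 0 x).1 (hx' 0).2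
  refine ⟨a, ?_, ?_⟩
  · rintro _ ⟨k, rfl⟩
    exact (hφ k a).1 (hx' k).1
  · rintro _ ⟨k, rfl⟩
    obtain ⟨b, hb, hab⟩ := (hψ k a).1 (hx' k).2
    rwa [WithTop.coe_inj.1 hab]

end Glue

theorem exists_embedding_of_sameAtomicType (conv : Convention) (M N : Type) [Lang.Structure M]
    [Lang.Structure N] [hM : M ⊨ TpdgStar conv] [hN : N ⊨ TpdgStar conv] [Countable M]
    (hs : CountablySaturated Lang N) {β : Type} (v : β → M) (w : β → N)
    (hvw : SameAtomicType Lang v w) : ∃ f : M ↪[Lang] N, f ∘ v = w := by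
  obtain ⟨Γ, _, _, _, χ, c, h, ⟨i⟩⟩ := (models_iff_isExpansion conv M).1 hM
  obtain ⟨Γ', _, _, _, χ', c', h', ⟨j⟩⟩ := (models_iff_isExpansion conv N).1 hN
  let _ := expansion conv χ c
  let _ := expansion conv χ' c'
  obtain ⟨_⟩ := h.nonempty_module
  obtain ⟨_⟩ := h'.nonempty_module
  have hc : Countable Γ := by
    have h1 : Countable (WithTop Γ) := i.symm.injective.countable
    exact (WithTop.coe_injective (α := Γ)).countable
  have hcut : CutSaturated χ' :=
    CutSaturated.of_countablySaturated (conv := conv) (c := c') h'.toIsPrecontraction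
      (hs.of_equiv j)
  have htype : SameAtomicType Lang (i ∘ v) (j ∘ w) :=
    hvw.comp_embedding i.toEmbedding j.toEmbedding
  obtain ⟨f, hf, hext⟩ := (isPartialIso_of_sameAtomicType htype).exists_map h h' hcut
  obtain ⟨g, hg⟩ := hf.exists_embedding
  refine ⟨(j.symm.toEmbedding.comp g).comp i.toEmbedding, funext fun b => ?_⟩
  change j.symm (g (i (v b))) = w b
  -- Variables are terms, so the given tuples are themselves matched by the partial isomorphism.
  rw [hg, hext (i (v b)) (j (w b)) ⟨Term.var b, rfl, rfl⟩, j.symm_apply_apply]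

end Pdg

theorem mainTheorem4 (conv : Pdg.Convention) : Pdg.HasQE (Pdg.TpdgStar conv) := by
  intro n φ
  exact FirstOrder.Language.Theory.exists_isQF_of_embedding _ Pdg.card_lang_le
    (fun M N _ _ _ _ _ hs _ v w hvw =>
      Pdg.exists_embedding_of_sameAtomicType conv M N hs v w hvw) φ
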